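/- Fix integers $m\ge 1$, $n\ge m+2$ and $r$. For every $p>n$ let $X_1,\dots,X_n\in\mathbb R^p$ (depending on $p$, all defined on one probability space) be an i.i.d. sample from an absolutely continuous distribution with mean $\mu$ and positive definite covariance matrix $\Sigma=\sum_{k=1}^p\lambda_k u_ku_k^\top$, where $u_1,\dots,u_p$ are orthonormal and $\lambda_1\ge\dots\ge\lambda_p$. Assume: (1) (Spiked covariance.) $\lambda_k=\sigma_k^2p+\tau_k^2$ for $k\le m$ and $\lambda_k=\tau_k^2$ for $m<k\le p$, where $\sigma_k^2>0$ does not depend on $p$, $\tau_k^2=\tau_{k,p}^2>0$ is bounded uniformly in $k\le p$ and $p$, and $\frac1p\sum_{k=1}^p\tau_k^2\to\tau^2$ as $p\to\infty$ for a constant $\tau^2>0$. (2) (Mixing.) For each $i\le n$ there is an infinite sequence $(z_{1i},z_{2i},\dots)$, not depending on $p$, such that for every $p>n$ its first $p$ terms are a.s. the standardized PC scores $z_{ki}=\lambda_k^{-1/2}u_k^\top(X_i-\mu)$, $k\le p$. The fourth moments $E z_{ki}^4$ are uniformly bounded, and after some permutation of its terms the sequence is $\rho$-mixing, that is, $\sup_j\rho\big(\sigma(\xi_k:k\le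 j),\sigma(\xi_k:k\ge j+l)\big)\to0$ as $l\to\infty$ for the permuted sequence $(\xi_k)$, where $\rho(\mathcal A,\mathcal B)$ is the supremum of $|\mathrm{Corr}(f,g)|$ over square-integrable $\mathcal A$-measurable $f$ and $\mathcal B$-measurable $g$. (3) (Reference directions.) $v_1,\dots,v_r\in\mathbb R^p$ are deterministic unit vectors (depending on $p$) such that, as $p\to\infty$, the norm of the orthogonal projection of $v_j$ onto $\operatorname{span}(u_1,\dots,u_m)$ converges to a constant $a_j\in[0,1]$ and $v_j^\top u_i\to a_{ji}\in[-1,1]$ for all $j\le r$, $i\le m$. Let $S=\frac1n\sum_{i=1}^n(X_i-\bar X)(X_i-\bar X)^\top=\sum_{k=1}^{n-1}\hat\lambda_k\hat u_k\hat u_k^\top$ be an eigendecomposition of the sample covariance matrix, with $\hat u_1,\dots,\hat u_{n-1}$ orthonormal and $\hat\lambda_1\ge\dots\ge\hat\lambda_{n-1}$, and let $S_m=\sum_{k=1}^m\hat\lambda_k\hat u_k\hat u_k^\top$, $\tilde\lambda=\frac1{n-m-1}\sum_{k=m+1}^{n-1}\hat\lambda_k$, and $d_j=-\tilde\lambda(S_m-\tilde\lambda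 I_p)^{-1}v_j$ for $j\le r$. Then, for all $i\le m$ and $j\le r$, with probability tending to one as $p\to\infty$ the matrix $S_m-\tilde\lambda I_p$ is invertible and $d_j\ne0$, and $$\operatorname{Angle}(u_i,d_j)\xrightarrow{P}\frac{\pi}{2}\qquad(p\to\infty).$$ -/

import Mathlib

open MeasureTheory ProbabilityTheory Filter Topology

noncomputable section

/-! All indices are zero-based: the direction with index `k` is the `(k+1)`-st one. Families that
depend on the dimension `p` are indexed by `k : ℕ`; only the indices below the relevant bound
(`p`, `m` or `n - 1`) carry meaning. -/

/-- The rank-one matrix `x xᵀ`. -/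
def outerSelf {p : ℕ} (x : EuclideanSpace ℝ (Fin p)) : Matrix (Fin p) (Fin p) ℝ :=
  Matrix.vecMulVec x.ofLp x.ofLp

/-- The covariance matrix of a random vector in `ℝᵖ`. -/
def covMatrix {Ω : Type*} [MeasurableSpace Ω] (P : Measure Ω) {p : ℕ}
    (Y : Ω → EuclideanSpace ℝ (Fin p)) : Matrix (Fin p) (Fin p) ℝ :=
  fun a b => cov[fun ω => Y ω a, fun ω => Y ω b; P]

/-- `X 0, …, X (n-1)` is an i.i.d. sample from a distribution on `ℝᵖ` that is absolutely continuous
with respect to Lebesgue measure and has mean `mean` and positive definite covariance matrix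
`Sig`. -/
structure IsSample {Ω : Type*} [MeasurableSpace Ω] (P : Measure Ω) {n p : ℕ}
    (X : Fin n → Ω → EuclideanSpace ℝ (Fin p)) (mean : EuclideanSpace ℝ (Fin p))
    (Sig : Matrix (Fin p) (Fin p) ℝ) : Prop where
  measurable : ∀ i, Measurable (X i)
  indep : iIndepFun X P
  identDistrib : ∀ i i', IdentDistrib (X i) (X i') P P
  absolutelyContinuous : ∀ i, P.map (X i) ≪ volume
  memLp : ∀ i, MemLp (X i) 2 P
  mean_eq : ∀ i, ∫ ω, X i ω ∂P = mean
  cov_eq : ∀ i, covMatrix P (X i) = Sig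
  posDef : Sig.PosDef

/-- `A = ∑_{k < N} ev k • (w k)(w k)ᵀ` with orthonormal `w 0, …, w (N-1)` and
`ev 0 ≥ ⋯ ≥ ev (N-1)`. -/
structure IsOrderedEigendecomposition {p : ℕ} (N : ℕ) (A : Matrix (Fin p) (Fin p) ℝ)
    (ev : ℕ → ℝ) (w : ℕ → EuclideanSpace ℝ (Fin p)) : Prop where
  orthonormal : Orthonormal ℝ (fun k : Fin N => w k)
  antitone : ∀ k l, k ≤ l → l < N → ev l ≤ ev k
  eq_sum : A = ∑ k ∈ Finset.range N, ev k • outerSelf (w k)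

/-- The spiked covariance model with `m` spikes, for all dimensions `p > n`: the eigenvalues are
`lam p k = sigSq k * p + tauSq p k` for the spiked indices and `lam p k = tauSq p k` for the other
ones, `tauSq` is uniformly bounded, and its average over the `p` indices tends to `tau2`. -/
structure IsSpikedCovariance (n m : ℕ) (lam : ℕ → ℕ → ℝ) (sigSq : ℕ → ℝ) (tauSq : ℕ → ℕ → ℝ)
    (tau2 : ℝ) : Prop where
  sigSq_pos : ∀ k < m, 0 < sigSq k
  tauSq_pos : ∀ p, n < p → ∀ k < p, 0 < tauSq p k
  spiked : ∀ p, n < p → ∀ k < m, lam p k = sigSq k * p + tauSq p k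
  nonspiked : ∀ p, n < p → ∀ k, m ≤ k → k < p → lam p k = tauSq p k
  bounded : ∃ C : ℝ, ∀ p, n < p → ∀ k < p, tauSq p k ≤ C
  tau2_pos : 0 < tau2
  average : Tendsto (fun p : ℕ => (∑ k ∈ Finset.range p, tauSq p k) / (p : ℝ)) atTop (𝓝 tau2)

/-- The standardized true PC score `ℓ^{-1/2} wᵀ (x - mean)` of an observation `x` with respect to
the direction `w` with variance `ℓ`. -/
def pcScore {p : ℕ} (mean : EuclideanSpace ℝ (Fin p)) (l : ℝ) (w x : EuclideanSpace ℝ (Fin p)) :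
    ℝ :=
  inner ℝ w (x - mean) / √l

/-- The maximal correlation coefficient `ρ(𝓐, 𝓑)` of two σ-algebras: the supremum of
`|Corr(f, g)|` over square-integrable `𝓐`-measurable `f` and `𝓑`-measurable `g`. A pair in which
one of the two is a.s. constant contributes `0`. -/
def maximalCorrelation {Ω : Type*} [MeasurableSpace Ω] (P : Measure Ω)
    (A B : MeasurableSpace Ω) : ℝ :=
  sSup {c : ℝ | ∃ f g : Ω → ℝ, Measurable[A] f ∧ Measurable[B] g ∧ MemLp f 2 P ∧ MemLp g 2 P ∧
    c = |cov[f, g; P]| / (√(Var[f; P]) * √(Var[g; P]))}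

/-- The `ρ`-mixing coefficient at lag `l` of a sequence of random variables:
`sup_j ρ(σ(ξ_k, k ≤ j), σ(ξ_k, k ≥ j + l))`. -/
def rhoMixingCoeff {Ω : Type*} [MeasurableSpace Ω] (P : Measure Ω) (ξ : ℕ → Ω → ℝ) (l : ℕ) : ℝ :=
  ⨆ j : ℕ, maximalCorrelation P
    (⨆ k : {k : ℕ // k ≤ j}, MeasurableSpace.comap (ξ k) inferInstance)
    (⨆ k : {k : ℕ // j + l ≤ k}, MeasurableSpace.comap (ξ k) inferInstance)

/-- A sequence of random variables is `ρ`-mixing if its mixing coefficients tend to zero. -/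
def IsRhoMixing {Ω : Type*} [MeasurableSpace Ω] (P : Measure Ω) (ξ : ℕ → Ω → ℝ) : Prop :=
  Tendsto (rhoMixingCoeff P ξ) atTop (𝓝 0)

/-- For every observation `i`, the standardized scores `score p 0 i, …, score p (p-1) i` in each
dimension `p > n` are a.s. the first `p` terms of one infinite sequence `Z · i`, which is `ρ`-mixing
after some permutation of its terms; the fourth moments are uniformly bounded. -/
def IsMixingScores {Ω : Type*} [MeasurableSpace Ω] (P : Measure Ω) {n : ℕ}
    (score : ℕ → ℕ → Fin n → Ω → ℝ) : Prop :=
  ∃ Z : ℕ → Fin n → Ω → ℝ,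
    (∀ k i, Measurable (Z k i)) ∧
    (∀ p, n < p → ∀ k < p, ∀ i, score p k i =ᵐ[P] Z k i) ∧
    (∃ C : ℝ, ∀ k i, Integrable (fun ω => Z k i ω ^ 4) P ∧ ∫ ω, Z k i ω ^ 4 ∂P ≤ C) ∧
    (∀ i, ∃ e : Equiv.Perm ℕ, IsRhoMixing P (fun k => Z (e k) i))

/-- The alignment of the reference directions `v p 0, …, v p (r-1)` with the true PC directions:
the norms of the projections onto `span (u p 0, …, u p (m-1))` and the inner products with the
true PC directions converge. -/
def HasLimitingAlignment {r : ℕ} (m : ℕ) (u : ∀ p : ℕ, ℕ → EuclideanSpace ℝ (Fin p))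
    (v : ∀ p : ℕ, Fin r → EuclideanSpace ℝ (Fin p)) : Prop :=
  (∃ a : Fin r → ℝ, ∀ j, a j ∈ Set.Icc (0 : ℝ) 1 ∧
    Tendsto (fun p => ‖(Submodule.span ℝ (u p '' Set.Iio m)).starProjection (v p j)‖) atTop
      (𝓝 (a j))) ∧
  (∃ a : Fin r → ℕ → ℝ, ∀ j, ∀ i < m, a j i ∈ Set.Icc (-1 : ℝ) 1 ∧
    Tendsto (fun p => inner ℝ (v p j) (u p i)) atTop (𝓝 (a j i)))

/-- The sample mean. -/
def sampleMean {n p : ℕ} (x : Fin n → EuclideanSpace ℝ (Fin p)) : EuclideanSpace ℝ (Fin p) :=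
  (n : ℝ)⁻¹ • ∑ i, x i

/-- The sample covariance matrix `n⁻¹ ∑ᵢ (xᵢ - x̄)(xᵢ - x̄)ᵀ`. -/
def sampleCov {n p : ℕ} (x : Fin n → EuclideanSpace ℝ (Fin p)) : Matrix (Fin p) (Fin p) ℝ :=
  (n : ℝ)⁻¹ • ∑ i, outerSelf (x i - sampleMean x)

/-- The spiked part `S_m = ∑_{k < m} ev k • (w k)(w k)ᵀ`. -/
def spikedPart {p : ℕ} (m : ℕ) (ev : ℕ → ℝ) (w : ℕ → EuclideanSpace ℝ (Fin p)) :
    Matrix (Fin p) (Fin p) ℝ :=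
  ∑ k ∈ Finset.range m, ev k • outerSelf (w k)

/-- The average of the `n - m - 1` non-spiked sample eigenvalues `ev m, …, ev (n-2)`. -/
def nonspikedAverage (n m : ℕ) (ev : ℕ → ℝ) : ℝ :=
  (∑ k ∈ Finset.Ico m (n - 1), ev k) / ((n : ℝ) - m - 1)

/-- The matrix `S_m - λ̃ I`. -/
def ridgedMatrix {p : ℕ} (n m : ℕ) (ev : ℕ → ℝ) (w : ℕ → EuclideanSpace ℝ (Fin p)) :
    Matrix (Fin p) (Fin p) ℝ :=
  spikedPart m ev w - nonspikedAverage n m ev • (1 : Matrix (Fin p) (Fin p) ℝ)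

/-- The negatively ridged discriminant vector `-λ̃ (S_m - λ̃ I)⁻¹ y`. -/
def ridgedVector {p : ℕ} (n m : ℕ) (ev : ℕ → ℝ) (w : ℕ → EuclideanSpace ℝ (Fin p))
    (y : EuclideanSpace ℝ (Fin p)) : EuclideanSpace ℝ (Fin p) :=
  WithLp.toLp 2 (-(nonspikedAverage n m ev) • ((ridgedMatrix n m ev w)⁻¹.mulVec y.ofLp))

end

/-!
# Asymptotic orthogonality of negatively ridged discriminant vectors

Put `A = p^{-1/2} (X_1 - μ, …, X_n - μ)`, restricted to the contrasts in `ℝⁿ` (the vectors whose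
coordinates sum to zero). Then `A Aᵀ` is `n / p` times the sample covariance matrix, so its nonzero
eigenvalues are `ev k = n λ̂_k / p`. Let `W` be the span of the `m` spiked directions, `Q` the
projection onto `W`, and `t = τ²`. As `p → ∞` with `n` fixed, the noise `(1 - Q) A` becomes `√t`
times an isometry, `Aᵀ (1 - Q) v → 0` for the reference direction `v`, and the signal `Q A` is
governed by the `m × n` matrix of leading scores, which does not depend on `p` and has full rank
almost surely.

*Linear algebra.* These facts force the eigenvalues with index at least `m` to be close to `t`
(`IsSpikedOperator.le_ev`, `IsSpikedOperator.ev_le_of_nonspiked`) and keep the other ones away from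
`t` (`IsSpikedOperator.le_ev_of_spiked`). Hence the ridge is close to `t`, the ridged matrix is
invertible and the ridged vector `d` is bounded away from zero. The equation for `d` reads
`d = v + A x` with `x = ∑_{k < m} (⟨û_k, d⟩ / ridge) Aᵀ û_k`. Since `Aᵀ A x` is explicit in the
eigenbasis and `Aᵀ (1 - Q) A x ≈ t x`, everything in
`Aᵀ Q d = Aᵀ Q v + Aᵀ A x - Aᵀ (1 - Q) A x` cancels up to small terms, so that `Aᵀ Q d ≈ 0`. As `Aᵀ`
is bounded below on `W`, this gives `Q d ≈ 0`
(`IsSpikedOperator.norm_starProjection_le_of_ridged_eq`). The bounds are explicit and do not involve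
`p`, which yields a noise threshold that is uniform in the dimension
(`IsSpikedOperator.exists_noise_threshold`).

*Probability.* The off-diagonal entries of the Gram matrix of the noise have variance `O(1 / p)`,
because the scores are uncorrelated and the observations independent. The diagonal entries converge
by `ρ`-mixing: the squared scores of most pairs of directions are almost uncorrelated, whatever the
permutation, because only few positions are close to a given one (`tendsto_average_dist`,
`IsWhiteScores.tendsto_measure_le_abs_sq_sub_one`). The leading scores are in general position since
a proper affine subspace is null for an absolutely continuous distribution
(`ae_linearIndependent_sub`); a single random variable, which does not depend on `p`, then bounds
the signal from both sides and is tight.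
-/

noncomputable section

/-! ### Orthonormal families indexed by natural numbers below a bound -/

section OrthonormalFamily

variable {V : Type*} [NormedAddCommGroup V] [InnerProductSpace ℝ V] {N : ℕ} {w : ℕ → V}

lemma inner_of_orthonormal_fin (hw : Orthonormal ℝ (fun k : Fin N => w k)) {k l : ℕ} (hk : k < N)
    (hl : l < N) : inner ℝ (w k) (w l) = if k = l then (1 : ℝ) else 0 := by
  have := orthonormal_iff_ite.1 hw ⟨k, hk⟩ ⟨l, hl⟩
  simpa using this

lemma inner_sum_smul_of_orthonormal_fin (hw : Orthonormal ℝ (fun k : Fin N => w k)) {s : Finset ℕ}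
    (hs : s ⊆ Finset.range N) (a : ℕ → ℝ) {l : ℕ} (hl : l < N) :
    inner ℝ (w l) (∑ k ∈ s, a k • w k) = if l ∈ s then a l else 0 := by
  rw [inner_sum, ← Finset.sum_ite_eq s l a]
  refine Finset.sum_congr rfl fun k hk => ?_
  rw [inner_smul_right, inner_of_orthonormal_fin hw hl (Finset.mem_range.1 (hs hk))]
  split_ifs <;> simp

lemma norm_sq_sum_smul_of_orthonormal_fin (hw : Orthonormal ℝ (fun k : Fin N => w k))
    {s : Finset ℕ} (hs : s ⊆ Finset.range N) (a : ℕ → ℝ) :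
    ‖∑ k ∈ s, a k • w k‖ ^ 2 = ∑ k ∈ s, a k ^ 2 := by
  rw [← real_inner_self_eq_norm_sq, sum_inner]
  refine Finset.sum_congr rfl fun k hk => ?_
  rw [real_inner_smul_left, inner_sum_smul_of_orthonormal_fin hw hs a (Finset.mem_range.1 (hs hk)),
    if_pos hk, sq]

lemma sum_inner_sq_le_of_orthonormal_fin (hw : Orthonormal ℝ (fun k : Fin N => w k))
    {s : Finset ℕ} (hs : s ⊆ Finset.range N) (y : V) :
    ∑ k ∈ s, inner ℝ (w k) y ^ 2 ≤ ‖y‖ ^ 2 := by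
  have h1 := norm_sq_sum_smul_of_orthonormal_fin hw hs (fun k => inner ℝ (w k) y)
  have h2 : inner ℝ (∑ k ∈ s, inner ℝ (w k) y • w k) y = ∑ k ∈ s, inner ℝ (w k) y ^ 2 := by
    rw [sum_inner]
    exact Finset.sum_congr rfl fun k _ => by rw [real_inner_smul_left, sq]
  have h3 := real_inner_le_norm (∑ k ∈ s, inner ℝ (w k) y • w k) y
  rw [h2, ← h1] at h3
  rw [← h1]
  nlinarith [norm_nonneg (∑ k ∈ s, inner ℝ (w k) y • w k), norm_nonneg y]

end OrthonormalFamily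

/-! ### Eigenvalues of a spiked operator -/

lemma norm_sq_eq_starProjection_add {V : Type*} [NormedAddCommGroup V] [InnerProductSpace ℝ V]
    [FiniteDimensional ℝ V] (W : Submodule ℝ V) (y : V) :
    ‖y‖ ^ 2 = ‖W.starProjection y‖ ^ 2 + ‖y - W.starProjection y‖ ^ 2 := by
  have h1 : inner ℝ (W.starProjection y) (y - W.starProjection y) = (0 : ℝ) := by
    have := Submodule.starProjection_inner_eq_zero (K := W) y (W.starProjection y)
      (Submodule.starProjection_apply_mem _ _)
    rw [real_inner_comm]; exact this
  have h2 := norm_add_sq_real (W.starProjection y) (y - W.starProjection y)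
  rw [h1] at h2
  simpa using h2

/-- A linear map `A : H → V` with adjoint `A'`, whose Gram operator `A A'` has the eigenvalues
`ev 0 ≥ ⋯ ≥ ev (N-1)` and eigenvectors `w k`, where `N = dim H`, and which consists of a signal
with values in `W` and of a noise part orthogonal to `W`. The noise part is, up to a relative error
`ε`, `√t` times an isometry, and the squared singular values of the signal part lie between `c` and
`M`. For the sample covariance, `H` is the space of contrasts in `ℝⁿ`, so that centring is built
in, `A` maps a contrast to the corresponding combination of the observations, and `W` is spanned by
the spiked directions. -/
structure IsSpikedOperator {H V : Type*} [NormedAddCommGroup H] [InnerProductSpace ℝ H]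
    [NormedAddCommGroup V] [InnerProductSpace ℝ V] [FiniteDimensional ℝ V]
    (A : H →ₗ[ℝ] V) (A' : V →ₗ[ℝ] H) (W : Submodule ℝ V) (N : ℕ) (ev : ℕ → ℝ) (w : ℕ → V)
    (t ε c M : ℝ) : Prop where
  adjoint : ∀ x y, inner ℝ (A x) y = inner ℝ x (A' y)
  orthonormal : Orthonormal ℝ (fun k : Fin N => w k)
  antitone : ∀ k l, k ≤ l → l < N → ev l ≤ ev k
  nonneg : 0 ≤ M
  gram : ∀ y, A (A' y) = ∑ k ∈ Finset.range N, (ev k * inner ℝ (w k) y) • w k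
  finrank_eq : Module.finrank ℝ H = N
  noise : ∀ x, ‖A' (A x - W.starProjection (A x)) - t • x‖ ≤ ε * ‖x‖
  signal_lower : ∀ y ∈ W, c * ‖y‖ ^ 2 ≤ ‖A' y‖ ^ 2
  signal_upper : ∀ y ∈ W, ‖A' y‖ ^ 2 ≤ M * ‖y‖ ^ 2

namespace IsSpikedOperator

variable {H V : Type*} [NormedAddCommGroup H] [InnerProductSpace ℝ H]
  [NormedAddCommGroup V] [InnerProductSpace ℝ V] [FiniteDimensional ℝ V]
  {A : H →ₗ[ℝ] V} {A' : V →ₗ[ℝ] H} {W : Submodule ℝ V} {N m : ℕ} {ev : ℕ → ℝ} {w : ℕ → V}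
  {t ε c M : ℝ}

lemma inner_adjoint_adjoint (h : IsSpikedOperator A A' W N ev w t ε c M) (y z : V) :
    inner ℝ (A' y) (A' z) = ∑ k ∈ Finset.range N, ev k * inner ℝ (w k) y * inner ℝ (w k) z := by
  rw [← h.adjoint, h.gram, sum_inner]
  exact Finset.sum_congr rfl fun k _ => by rw [real_inner_smul_left]

lemma norm_sq_adjoint (h : IsSpikedOperator A A' W N ev w t ε c M) (y : V) :
    ‖A' y‖ ^ 2 = ∑ k ∈ Finset.range N, ev k * inner ℝ (w k) y ^ 2 := by
  rw [← real_inner_self_eq_norm_sq, h.inner_adjoint_adjoint]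
  exact Finset.sum_congr rfl fun k _ => by ring

lemma norm_sq_gram (h : IsSpikedOperator A A' W N ev w t ε c M) (y : V) :
    ‖A (A' y)‖ ^ 2 = ∑ k ∈ Finset.range N, ev k ^ 2 * inner ℝ (w k) y ^ 2 := by
  rw [h.gram, norm_sq_sum_smul_of_orthonormal_fin h.orthonormal subset_rfl]
  exact Finset.sum_congr rfl fun k _ => by ring

lemma apply_adjoint_eigenvector (h : IsSpikedOperator A A' W N ev w t ε c M) {k : ℕ}
    (hk : k < N) : A (A' (w k)) = ev k • w k := by
  rw [h.gram, Finset.sum_eq_single k]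
  · rw [inner_of_orthonormal_fin h.orthonormal hk hk]; simp
  · intro l hl hlk
    rw [inner_of_orthonormal_fin h.orthonormal (Finset.mem_range.1 hl) hk, if_neg hlk]; simp
  · simp [hk]

lemma norm_sq_adjoint_eigenvector (h : IsSpikedOperator A A' W N ev w t ε c M) {k : ℕ}
    (hk : k < N) : ‖A' (w k)‖ ^ 2 = ev k := by
  rw [← real_inner_self_eq_norm_sq, ← h.adjoint, h.apply_adjoint_eigenvector hk,
    real_inner_smul_left, inner_of_orthonormal_fin h.orthonormal hk hk, if_pos rfl, mul_one]

lemma ev_nonneg (h : IsSpikedOperator A A' W N ev w t ε c M) {k : ℕ} (hk : k < N) : 0 ≤ ev k :=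
  h.norm_sq_adjoint_eigenvector hk ▸ sq_nonneg _

/-- The noise hypothesis as a statement about quadratic forms. -/
lemma norm_sq_noise (h : IsSpikedOperator A A' W N ev w t ε c M) (x : H) :
    |‖A x - W.starProjection (A x)‖ ^ 2 - t * ‖x‖ ^ 2| ≤ ε * ‖x‖ ^ 2 := by
  have h1 : inner ℝ (A x - W.starProjection (A x)) (W.starProjection (A x)) = (0 : ℝ) :=
    Submodule.starProjection_inner_eq_zero (K := W) (A x) (W.starProjection (A x))
      (Submodule.starProjection_apply_mem _ _)
  have h2 : ‖A x - W.starProjection (A x)‖ ^ 2 - t * ‖x‖ ^ 2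
      = inner ℝ x (A' (A x - W.starProjection (A x)) - t • x) := by
    rw [inner_sub_right, ← h.adjoint, inner_smul_right, real_inner_self_eq_norm_sq,
      ← real_inner_self_eq_norm_sq]
    have : inner ℝ (A x) (A x - W.starProjection (A x))
        = inner ℝ (A x - W.starProjection (A x)) (A x - W.starProjection (A x))
          + inner ℝ (A x - W.starProjection (A x)) (W.starProjection (A x)) := by
      rw [← inner_add_right, real_inner_comm]; simp
    rw [this, h1]; ring
  rw [h2]
  calc _ ≤ ‖x‖ * ‖A' (A x - W.starProjection (A x)) - t • x‖ := abs_real_inner_le_norm _ _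
    _ ≤ ‖x‖ * (ε * ‖x‖) := by gcongr; exact h.noise x
    _ = _ := by ring

/-- The signal part of `A` has the same norm bound as its adjoint, the restriction of `A'` to
`W`. -/
lemma norm_sq_signal_le (h : IsSpikedOperator A A' W N ev w t ε c M) (x : H) :
    ‖W.starProjection (A x)‖ ^ 2 ≤ M * ‖x‖ ^ 2 := by
  set y := W.starProjection (A x) with hy
  have h0 : y ∈ W := Submodule.starProjection_apply_mem _ _
  have h1 : inner ℝ (A x - y) y = (0 : ℝ) :=
    Submodule.starProjection_inner_eq_zero (K := W) (A x) y h0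
  have h2 : ‖y‖ ^ 2 = inner ℝ x (A' y) := by
    rw [← h.adjoint, ← real_inner_self_eq_norm_sq]
    rw [inner_sub_left] at h1; linarith
  have h3 := real_inner_le_norm x (A' y)
  have h4 := h.signal_upper y h0
  rcases (norm_nonneg y).eq_or_lt with h5 | h5
  · rw [← h5]
    have := mul_nonneg h.nonneg (sq_nonneg ‖x‖)
    simpa using this
  · have h6 : (‖y‖ ^ 2) ^ 2 ≤ ‖x‖ ^ 2 * (M * ‖y‖ ^ 2) := by
      calc (‖y‖ ^ 2) ^ 2 ≤ (‖x‖ * ‖A' y‖) ^ 2 := by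
            gcongr; rw [h2]; exact h3
        _ = ‖x‖ ^ 2 * ‖A' y‖ ^ 2 := by ring
        _ ≤ _ := by gcongr
    have h7 : 0 < ‖y‖ ^ 2 := by positivity
    nlinarith


/-- The lower half of the min-max principle: if `‖A x‖² ≥ q ‖x‖²` on a space of dimension greater
than `j`, then the eigenvalue with index `j` is at least `q`. -/
lemma le_ev_of_lt_finrank (h : IsSpikedOperator A A' W N ev w t ε c M) (K : Submodule ℝ H)
    {j : ℕ} (hj : j < N) (hK : j < Module.finrank ℝ K) {q : ℝ}
    (hq : ∀ x ∈ K, q * ‖x‖ ^ 2 ≤ ‖A x‖ ^ 2) : q ≤ ev j := by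
  have : FiniteDimensional ℝ K := Module.finite_of_finrank_pos (by omega)
  let f : K →ₗ[ℝ] (Fin j → ℝ) :=
    LinearMap.pi fun k => (innerₛₗ ℝ (w k)) ∘ₗ A ∘ₗ K.subtype
  have hker : LinearMap.ker f ≠ ⊥ := LinearMap.ker_ne_bot_of_finrank_lt (by simpa using hK)
  obtain ⟨x, hxf, hx0⟩ := Submodule.exists_mem_ne_zero_of_ne_bot hker
  have hin : ∀ k < j, inner ℝ (w k) (A x) = (0 : ℝ) := fun k hk =>
    congrFun (LinearMap.mem_ker.1 hxf) ⟨k, hk⟩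
  have hx : 0 < ‖(x : H)‖ ^ 2 := by
    have : (x : H) ≠ 0 := by simpa using hx0
    positivity
  have hev := h.ev_nonneg hj
  have h1 := hq x x.2
  have h2 : ‖A' (A x)‖ ^ 2 ≤ ev j * ‖A x‖ ^ 2 := by
    rw [h.norm_sq_adjoint]
    calc _ ≤ ∑ k ∈ Finset.range N, ev j * inner ℝ (w k) (A x) ^ 2 := by
          refine Finset.sum_le_sum fun k hk => ?_
          rcases lt_or_ge k j with hkj | hkj
          · simp [hin k hkj]
          · gcongr
            exact h.antitone _ _ hkj (Finset.mem_range.1 hk)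
      _ = ev j * ∑ k ∈ Finset.range N, inner ℝ (w k) (A x) ^ 2 := by rw [Finset.mul_sum]
      _ ≤ _ := by
          gcongr
          exact sum_inner_sq_le_of_orthonormal_fin h.orthonormal subset_rfl _
  have h3 : ‖A x‖ ^ 2 ≤ ‖(x : H)‖ * ‖A' (A x)‖ := by
    rw [← real_inner_self_eq_norm_sq, h.adjoint]
    exact real_inner_le_norm _ _
  have h4 : (‖A x‖ ^ 2) ^ 2 ≤ ‖(x : H)‖ ^ 2 * (ev j * ‖A x‖ ^ 2) := by
    calc _ ≤ (‖(x : H)‖ * ‖A' (A x)‖) ^ 2 := by gcongr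
      _ = ‖(x : H)‖ ^ 2 * ‖A' (A x)‖ ^ 2 := by ring
      _ ≤ _ := by gcongr
  rcases (sq_nonneg ‖A x‖).eq_or_lt with h5 | h5
  · rw [← h5] at h1
    nlinarith
  · have h6 : ‖A x‖ ^ 2 ≤ ‖(x : H)‖ ^ 2 * ev j := by nlinarith
    nlinarith

/-- No eigenvalue is smaller than the noise, because `dim H = N`. -/
lemma le_ev (h : IsSpikedOperator A A' W N ev w t ε c M) {j : ℕ} (hj : j < N) :
    t - ε ≤ ev j := by
  refine h.le_ev_of_lt_finrank ⊤ hj (by rw [finrank_top, h.finrank_eq]; exact hj) fun x _ => ?_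
  have h1 := abs_le.1 (h.norm_sq_noise x)
  have h2 := norm_sq_eq_starProjection_add W (A x)
  nlinarith [sq_nonneg ‖W.starProjection (A x)‖]

/-- The signal separates the spiked eigenvalues from the others. -/
lemma le_ev_of_spiked (h : IsSpikedOperator A A' W N ev w t ε c M) (hc : 0 < c)
    {j : ℕ} (hjN : j < N) (hj : j < Module.finrank ℝ W) : c + t - ε ≤ ev j := by
  have hinj : Function.Injective (A' ∘ₗ W.subtype) := by
    rw [injective_iff_map_eq_zero]
    intro y hy
    have h1 := h.signal_lower y y.2
    have h2 : A' y = 0 := hy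
    rw [h2] at h1
    have h3 : ‖(y : V)‖ ^ 2 = 0 := by
      simp only [norm_zero] at h1
      nlinarith [sq_nonneg ‖(y : V)‖]
    simpa using h3
  refine h.le_ev_of_lt_finrank (LinearMap.range (A' ∘ₗ W.subtype)) hjN
    (by rwa [LinearMap.finrank_range_of_inj hinj]) ?_
  rintro _ ⟨y, rfl⟩
  have h1 := abs_le.1 (h.norm_sq_noise (A' y))
  have h2 := norm_sq_eq_starProjection_add W (A (A' y))
  have h3 : ‖A' y‖ ^ 2 ≤ ‖W.starProjection (A (A' y))‖ * ‖(y : V)‖ := by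
    have h4 : inner ℝ (A (A' y) - W.starProjection (A (A' y))) (y : V) = (0 : ℝ) :=
      Submodule.starProjection_inner_eq_zero (K := W) _ _ y.2
    rw [inner_sub_left, h.adjoint, real_inner_self_eq_norm_sq] at h4
    have h5 := real_inner_le_norm (W.starProjection (A (A' y))) (y : V)
    linarith
  have h4 := h.signal_lower y y.2
  have h5 : c * ‖A' y‖ ^ 2 ≤ ‖W.starProjection (A (A' y))‖ ^ 2 := by
    rcases (norm_nonneg (A' y)).eq_or_lt with h6 | h6
    · rw [← h6]; simp
    · have h7 : c * (‖A' y‖ ^ 2) ^ 2 ≤ ‖W.starProjection (A (A' y))‖ ^ 2 * ‖A' y‖ ^ 2 :=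
        calc c * (‖A' y‖ ^ 2) ^ 2
            ≤ c * (‖W.starProjection (A (A' y))‖ * ‖(y : V)‖) ^ 2 := by gcongr
          _ = ‖W.starProjection (A (A' y))‖ ^ 2 * (c * ‖(y : V)‖ ^ 2) := by ring
          _ ≤ _ := by gcongr
      have h8 : 0 < ‖A' y‖ ^ 2 := by positivity
      nlinarith
  change (c + t - ε) * ‖A' y‖ ^ 2 ≤ ‖A (A' y)‖ ^ 2
  nlinarith

/-- The upper half of the min-max principle, for the eigenvalues that the signal does not reach. The
hypothesis `ε < t` keeps these eigenvalues away from zero. -/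
lemma ev_le_of_nonspiked (h : IsSpikedOperator A A' W N ev w t ε c M) (hε : ε < t) {j : ℕ}
    (hjN : j < N) (hj : Module.finrank ℝ W ≤ j) : ev j ≤ t + ε := by
  -- A nonzero combination `z` of the first `j + 1` eigenvectors such that `A' z` carries no signal.
  let g : (Fin (j + 1) → ℝ) →ₗ[ℝ] V :=
    Fintype.linearCombination ℝ (fun k : Fin (j + 1) => w k)
  have hg : ∀ b, g b = ∑ k : Fin (j + 1), b k • w k := fun b => rfl
  let f : (Fin (j + 1) → ℝ) →ₗ[ℝ] W :=
    (W.orthogonalProjectionOnto : V →ₗ[ℝ] W) ∘ₗ A ∘ₗ A' ∘ₗ g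
  have hker : LinearMap.ker f ≠ ⊥ :=
    LinearMap.ker_ne_bot_of_finrank_lt (by rw [Module.finrank_fin_fun]; omega)
  obtain ⟨b, hbf, hb0⟩ := Submodule.exists_mem_ne_zero_of_ne_bot hker
  have hP : W.starProjection (A (A' (g b))) = 0 := by
    have : f b = 0 := hbf
    have h1 : W.orthogonalProjectionOnto (A (A' (g b))) = 0 := this
    rw [Submodule.starProjection_apply, h1]; simp
  obtain ⟨a, ha⟩ : ∃ a : ℕ → ℝ, ∀ k : Fin (j + 1), a k = b k :=
    ⟨fun k => if hk : k < j + 1 then b ⟨k, hk⟩ else 0, fun k => dif_pos k.2⟩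
  have hgb : g b = ∑ k ∈ Finset.range (j + 1), a k • w k := by
    rw [hg, ← Fin.sum_univ_eq_sum_range (fun k => a k • w k)]
    exact Finset.sum_congr rfl fun k _ => by rw [ha]
  have hsub : Finset.range (j + 1) ⊆ Finset.range N := by
    intro k; simp only [Finset.mem_range]; omega
  set z := g b with hz
  have hin : ∀ k < N, inner ℝ (w k) z = if k ∈ Finset.range (j + 1) then a k else 0 :=
    fun k hk => by rw [hgb]; exact inner_sum_smul_of_orthonormal_fin h.orthonormal hsub a hk
  have hpos : 0 < ∑ k ∈ Finset.range N, inner ℝ (w k) z ^ 2 := by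
    obtain ⟨k, hk⟩ : ∃ k, b k ≠ 0 := by
      by_contra! hcon
      exact hb0 (funext hcon)
    refine Finset.sum_pos' (fun _ _ => sq_nonneg _) ⟨k, hsub (Finset.mem_range.2 k.2), ?_⟩
    rw [hin k (by omega), if_pos (Finset.mem_range.2 k.2), ha]
    positivity
  have h1 := abs_le.1 (h.norm_sq_noise (A' z))
  rw [hP, sub_zero] at h1
  have hle : ∀ k ∈ Finset.range N, inner ℝ (w k) z ^ 2 ≠ 0 → ev j ≤ ev k := by
    intro k hk hne
    rw [hin k (Finset.mem_range.1 hk)] at hne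
    by_cases hkj : k ∈ Finset.range (j + 1)
    · exact h.antitone _ _ (by simp at hkj; omega) hjN
    · simp [hkj] at hne
  have hevj := h.ev_nonneg hjN
  have h2 : ev j * ‖A' z‖ ^ 2 ≤ ‖A (A' z)‖ ^ 2 := by
    rw [h.norm_sq_adjoint, h.norm_sq_gram, Finset.mul_sum]
    refine Finset.sum_le_sum fun k hk => ?_
    by_cases h0 : inner ℝ (w k) z ^ 2 = 0
    · simp [h0]
    · have := hle k hk h0
      have h3 : ev j * (ev k * inner ℝ (w k) z ^ 2) = ev j * ev k * inner ℝ (w k) z ^ 2 := by ring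
      have h4 := h.ev_nonneg (Finset.mem_range.1 hk)
      rw [h3, sq (ev k)]
      gcongr
  have h3 : ev j * ∑ k ∈ Finset.range N, inner ℝ (w k) z ^ 2 ≤ ‖A' z‖ ^ 2 := by
    rw [h.norm_sq_adjoint, Finset.mul_sum]
    refine Finset.sum_le_sum fun k hk => ?_
    by_cases h0 : inner ℝ (w k) z ^ 2 = 0
    · simp [h0]
    · have := hle k hk h0
      gcongr
  have h4 := h.le_ev hjN
  have h5 : 0 < ‖A' z‖ ^ 2 := by
    have : 0 < ev j := by linarith
    have := mul_pos this hpos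
    linarith
  nlinarith

lemma ev_le (h : IsSpikedOperator A A' W N ev w t ε c M) (hε : ε < t) {j : ℕ} (hj : j < N) :
    ev j ≤ M + t + ε := by
  have h1 := h.norm_sq_adjoint_eigenvector hj
  have h2 : ‖A (A' (w j))‖ ^ 2 = ev j ^ 2 := by
    have hw : ‖w j‖ = 1 := h.orthonormal.1 ⟨j, hj⟩
    rw [h.apply_adjoint_eigenvector hj, norm_smul, hw, mul_one, Real.norm_eq_abs, sq_abs]
  have h3 := norm_sq_eq_starProjection_add W (A (A' (w j)))
  have h4 := abs_le.1 (h.norm_sq_noise (A' (w j)))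
  have h5 := h.norm_sq_signal_le (A' (w j))
  rw [h1] at h4 h5
  rw [h2] at h3
  have h6 := h.le_ev hj
  have h7 : 0 < ev j := by linarith
  nlinarith

end IsSpikedOperator

/-! ### The ridged vector of a spiked operator -/

namespace IsSpikedOperator

variable {H V : Type*} [NormedAddCommGroup H] [InnerProductSpace ℝ H]
  [NormedAddCommGroup V] [InnerProductSpace ℝ V] [FiniteDimensional ℝ V]
  {A : H →ₗ[ℝ] V} {A' : V →ₗ[ℝ] H} {W : Submodule ℝ V} {N m : ℕ} {ev : ℕ → ℝ} {w : ℕ → V}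
  {t ε c M : ℝ}

/-- The average of the nonspiked eigenvalues estimates the noise level `t`. -/
lemma abs_average_sub_le (h : IsSpikedOperator A A' W N ev w t ε c M) (hε : ε < t)
    (hW : Module.finrank ℝ W = m) (hm : m < N) :
    |(∑ k ∈ Finset.Ico m N, ev k) / ((N : ℝ) - m) - t| ≤ ε := by
  have hpos : (0 : ℝ) < (N : ℝ) - m := by
    have : (m : ℝ) < N := by exact_mod_cast hm
    linarith
  have hcard : (((Finset.Ico m N).card : ℕ) : ℝ) = (N : ℝ) - m := by
    rw [Nat.card_Ico, Nat.cast_sub hm.le]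
  have h1 : (Finset.Ico m N).card • (t - ε) ≤ ∑ k ∈ Finset.Ico m N, ev k :=
    Finset.card_nsmul_le_sum _ _ _ fun k hk => h.le_ev (Finset.mem_Ico.1 hk).2
  have h2 : ∑ k ∈ Finset.Ico m N, ev k ≤ (Finset.Ico m N).card • (t + ε) :=
    Finset.sum_le_card_nsmul _ _ _ fun k hk =>
      h.ev_le_of_nonspiked hε (Finset.mem_Ico.1 hk).2 (hW.trans_le (Finset.mem_Ico.1 hk).1)
  rw [nsmul_eq_mul, hcard] at h1 h2
  rw [abs_le]
  constructor
  · rw [neg_le_sub_iff_le_add, ← sub_le_iff_le_add, le_div_iff₀ hpos]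
    linarith
  · rw [sub_le_iff_le_add, div_le_iff₀ hpos]
    linarith

/-- The coordinates of the ridged vector `d` along the spiked eigenvectors. -/
lemma inner_eigenvector_of_ridged_eq (h : IsSpikedOperator A A' W N ev w t ε c M) (hm : m ≤ N)
    {s : ℝ} {v d : V}
    (hd : ∑ k ∈ Finset.range m, (ev k * inner ℝ (w k) d) • w k - s • d = -(s • v)) {k : ℕ}
    (hk : k < m) : (ev k - s) * inner ℝ (w k) d = -(s * inner ℝ (w k) v) := by
  have h1 := congrArg (fun z => inner ℝ (w k) z) hd
  simp only [inner_sub_right, inner_smul_right, inner_neg_right] at h1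
  rw [inner_sum_smul_of_orthonormal_fin h.orthonormal (Finset.range_subset_range.2 hm) _
    (hk.trans_le hm), if_pos (Finset.mem_range.2 hk)] at h1
  linarith

/-- The ridged operator is injective if its ridge `s` is neither zero nor one of the spiked
eigenvalues. -/
lemma eq_zero_of_ridged_eq_zero (h : IsSpikedOperator A A' W N ev w t ε c M) (hm : m ≤ N)
    {s : ℝ} (hs : s ≠ 0) (hev : ∀ k < m, ev k ≠ s) {d : V}
    (hd : ∑ k ∈ Finset.range m, (ev k * inner ℝ (w k) d) • w k - s • d = 0) : d = 0 := by
  have h1 : ∀ k < m, inner ℝ (w k) d = (0 : ℝ) := by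
    intro k hk
    have h2 := h.inner_eigenvector_of_ridged_eq (v := 0) hm (by simpa using hd) hk
    have h3 := sub_ne_zero.2 (hev k hk)
    simpa [h3] using h2
  rw [Finset.sum_eq_zero fun k hk => by rw [h1 k (Finset.mem_range.1 hk)]; simp] at hd
  simpa [hs] using hd

/-- A lower bound for the norm of the ridged vector. -/
lemma le_norm_of_ridged_eq (h : IsSpikedOperator A A' W N ev w t ε c M) (hm : m ≤ N)
    {s : ℝ} (hs : 0 < s) {K : ℝ} (hK0 : 0 ≤ K) (hK : ∀ k < m, ev k ≤ K) {v d : V} (hv : ‖v‖ = 1)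
    (hd : ∑ k ∈ Finset.range m, (ev k * inner ℝ (w k) d) • w k - s • d = -(s • v)) :
    s / (K + s) ≤ ‖d‖ := by
  have h1 : ‖∑ k ∈ Finset.range m, (ev k * inner ℝ (w k) d) • w k‖ ≤ K * ‖d‖ := by
    refine le_of_sq_le_sq ?_ (by positivity)
    rw [norm_sq_sum_smul_of_orthonormal_fin h.orthonormal (Finset.range_subset_range.2 hm)]
    calc _ ≤ ∑ k ∈ Finset.range m, K ^ 2 * inner ℝ (w k) d ^ 2 := by
          refine Finset.sum_le_sum fun k hk => ?_
          have hk := Finset.mem_range.1 hk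
          have := h.ev_nonneg (hk.trans_le hm)
          rw [mul_pow]
          gcongr
          exact hK k hk
      _ = K ^ 2 * ∑ k ∈ Finset.range m, inner ℝ (w k) d ^ 2 := by rw [Finset.mul_sum]
      _ ≤ K ^ 2 * ‖d‖ ^ 2 := by
          gcongr
          exact sum_inner_sq_le_of_orthonormal_fin h.orthonormal
            (Finset.range_subset_range.2 hm) _
      _ = _ := by ring
  have h2 : s = ‖s • d - ∑ k ∈ Finset.range m, (ev k * inner ℝ (w k) d) • w k‖ := by
    rw [← neg_sub, hd, neg_neg, norm_smul, hv, Real.norm_of_nonneg hs.le, mul_one]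
  have h3 := norm_sub_le (s • d) (∑ k ∈ Finset.range m, (ev k * inner ℝ (w k) d) • w k)
  rw [← h2, norm_smul, Real.norm_of_nonneg hs.le] at h3
  rw [div_le_iff₀ (by positivity)]
  linarith

/-- The part of `A' v` in the nonspiked eigenspaces is small if `v` has little noise: on these
eigenspaces the signal is negligible, because the noise alone exhausts the eigenvalues. -/
lemma norm_nonspiked_part_le (h : IsSpikedOperator A A' W N ev w t ε c M) (hε0 : 0 ≤ ε)
    (hε : ε < t) (hW : Module.finrank ℝ W = m) {v : V} (hv : ‖v‖ = 1)
    (hvn : ‖A' (v - W.starProjection v)‖ ≤ ε) :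
    ‖∑ k ∈ Finset.Ico m N, inner ℝ (w k) v • A' (w k)‖ ≤ √(2 * ε) + ε := by
  set z := ∑ k ∈ Finset.Ico m N, inner ℝ (w k) v • w k with hz
  have hq : ∑ k ∈ Finset.Ico m N, inner ℝ (w k) v • A' (w k) = A' z := by
    rw [hz, map_sum]; simp
  rw [hq]
  have hsub : Finset.Ico m N ⊆ Finset.range N := by
    intro k; simp only [Finset.mem_range, Finset.mem_Ico]; omega
  have hin : ∀ k < N, inner ℝ (w k) z = if k ∈ Finset.Ico m N then inner ℝ (w k) v else 0 :=
    fun k hk => inner_sum_smul_of_orthonormal_fin h.orthonormal hsub _ hk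
  have h1 : ‖A (A' z)‖ ^ 2 ≤ (t + ε) * ‖A' z‖ ^ 2 := by
    rw [h.norm_sq_adjoint, h.norm_sq_gram, Finset.mul_sum]
    refine Finset.sum_le_sum fun k hk => ?_
    rw [hin k (Finset.mem_range.1 hk)]
    split_ifs with hkm
    · have h2 := h.ev_nonneg (Finset.mem_range.1 hk)
      have h3 := h.ev_le_of_nonspiked hε (Finset.mem_range.1 hk)
        (hW.trans_le (Finset.mem_Ico.1 hkm).1)
      rw [sq (ev k), ← mul_assoc]
      gcongr
    · simp
  have h2 := norm_sq_eq_starProjection_add W (A (A' z))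
  have h3 := abs_le.1 (h.norm_sq_noise (A' z))
  have h4 : ‖W.starProjection (A (A' z))‖ ≤ √(2 * ε) * ‖A' z‖ := by
    refine le_of_sq_le_sq ?_ (by positivity)
    rw [mul_pow, Real.sq_sqrt (by positivity)]
    linarith
  have h5 : ‖A' z‖ ^ 2 = inner ℝ (A' z) (A' v) := by
    rw [h.norm_sq_adjoint, h.inner_adjoint_adjoint]
    refine Finset.sum_congr rfl fun k hk => ?_
    rw [hin k (Finset.mem_range.1 hk)]
    split_ifs <;> ring
  have h6 : inner ℝ (A' z) (A' v) = inner ℝ (W.starProjection (A (A' z))) v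
      + inner ℝ (A' z) (A' (v - W.starProjection v)) := by
    rw [Submodule.inner_starProjection_left_eq_right, h.adjoint, ← inner_add_right, ← map_add]
    simp
  have h7 := real_inner_le_norm (W.starProjection (A (A' z))) v
  have h8 := real_inner_le_norm (A' z) (A' (v - W.starProjection v))
  rw [hv, mul_one] at h7
  have h9 : ‖A' z‖ ^ 2 ≤ (√(2 * ε) + ε) * ‖A' z‖ := by
    have := mul_le_mul_of_nonneg_left hvn (norm_nonneg (A' z))
    linarith
  rcases (norm_nonneg (A' z)).eq_or_lt with h10 | h10
  · rw [← h10]; positivity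
  · nlinarith

/-- The ridged vector is almost orthogonal to the signal space `W`. Modulo noise, the equation
that defines it says that `A'` annihilates its projection onto `W`, and `A'` is bounded below
there. -/
lemma norm_starProjection_le_of_ridged_eq (h : IsSpikedOperator A A' W N ev w t ε c M)
    (hc : 0 < c) (hε0 : 0 ≤ ε) (hεt : ε < t) (hεc : 4 * ε ≤ c) (hW : Module.finrank ℝ W = m)
    (hm : m < N) {s : ℝ} (hs0 : 0 < s) (hs : |s - t| ≤ ε) {v d : V} (hv : ‖v‖ = 1)
    (hvn : ‖A' (v - W.starProjection v)‖ ≤ ε)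
    (hd : ∑ k ∈ Finset.range m, (ev k * inner ℝ (w k) d) • w k - s • d = -(s • v)) :
    √c * ‖W.starProjection d‖
      ≤ √(2 * ε) + 2 * ε + 2 * ε * (m * (2 / c * √(M + t + ε))) := by
  have hsub : Finset.range m ⊆ Finset.range N := Finset.range_subset_range.2 hm.le
  -- The preimage of `d - v` in the spiked eigenspaces.
  set x : H := ∑ k ∈ Finset.range m, (inner ℝ (w k) d / s) • A' (w k) with hx
  have hAx : A x = d - v := by
    have h1 : s • A x = ∑ k ∈ Finset.range m, (ev k * inner ℝ (w k) d) • w k := by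
      rw [hx, map_sum, Finset.smul_sum]
      refine Finset.sum_congr rfl fun k hk => ?_
      rw [map_smul, h.apply_adjoint_eigenvector ((Finset.mem_range.1 hk).trans hm), smul_smul,
        smul_smul]
      congr 1
      field_simp
    have h2 : s • A x = s • (d - v) := by
      rw [h1, smul_sub, sub_eq_add_neg (s • d), ← hd]; abel
    exact smul_right_injective V hs0.ne' h2
  have hcoef : ∀ k < m, (ev k - s) * (inner ℝ (w k) d / s) = - inner ℝ (w k) v := by
    intro k hk
    rw [mul_div_assoc', h.inner_eigenvector_of_ridged_eq hm.le hd hk]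
    field_simp
  have hgap : ∀ k < m, c / 2 ≤ ev k - s := by
    intro k hk
    have h1 := h.le_ev_of_spiked hc (hk.trans hm) (hW ▸ hk)
    have h2 := (abs_le.1 hs).2
    linarith
  -- `A' A x` is computed in the eigenbasis and compared with `s • x`.
  have hGx : A' (A x) = s • x - ∑ k ∈ Finset.range m, inner ℝ (w k) v • A' (w k) := by
    rw [hx, map_sum, map_sum, Finset.smul_sum, ← Finset.sum_sub_distrib]
    refine Finset.sum_congr rfl fun k hk => ?_
    rw [map_smul, map_smul, h.apply_adjoint_eigenvector ((Finset.mem_range.1 hk).trans hm),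
      map_smul, smul_smul,
      smul_smul, ← sub_smul]
    congr 1
    linarith [hcoef k (Finset.mem_range.1 hk)]
  have hAv : A' v = ∑ k ∈ Finset.range m, inner ℝ (w k) v • A' (w k)
      + ∑ k ∈ Finset.Ico m N, inner ℝ (w k) v • A' (w k) := by
    rw [Finset.sum_range_add_sum_Ico _ hm.le]
    have h1 : ‖A' (v - ∑ k ∈ Finset.range N, inner ℝ (w k) v • w k)‖ ^ 2 = 0 := by
      rw [h.norm_sq_adjoint]
      refine Finset.sum_eq_zero fun k hk => ?_
      rw [inner_sub_right, inner_sum_smul_of_orthonormal_fin h.orthonormal subset_rfl _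
        (Finset.mem_range.1 hk), if_pos hk]
      simp
    have h2 : A' (v - ∑ k ∈ Finset.range N, inner ℝ (w k) v • w k) = 0 := by simpa using h1
    rw [map_sub, sub_eq_zero, map_sum] at h2
    rw [h2]
    exact Finset.sum_congr rfl fun k _ => by rw [map_smul]
  set q := ∑ k ∈ Finset.Ico m N, inner ℝ (w k) v • A' (w k) with hq
  have hPd : A' (W.starProjection d) = -A' (v - W.starProjection v) + q + (s - t) • x
      - (A' (A x - W.starProjection (A x)) - t • x) := by
    have h1 : W.starProjection d = W.starProjection v + W.starProjection (A x) := by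
      rw [hAx, ← map_add]; simp
    have h2 : A' (A x - W.starProjection (A x)) = A' (A x) - A' (W.starProjection (A x)) :=
      map_sub _ _ _
    rw [h1, map_add, h2, hGx, map_sub, hAv, sub_smul]
    abel
  have hxn : ‖x‖ ≤ m * (2 / c * √(M + t + ε)) := by
    calc ‖x‖ ≤ ∑ k ∈ Finset.range m, ‖(inner ℝ (w k) d / s) • A' (w k)‖ := norm_sum_le _ _
      _ ≤ ∑ k ∈ Finset.range m, 2 / c * √(M + t + ε) := by
          refine Finset.sum_le_sum fun k hk => ?_
          have hk := Finset.mem_range.1 hk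
          rw [norm_smul]
          gcongr
          · have h1 := hgap k hk
            have h2 : |inner ℝ (w k) v| ≤ 1 := by
              have h3 := abs_real_inner_le_norm (w k) v
              have h4 : ‖w k‖ = 1 := h.orthonormal.1 ⟨k, hk.trans hm⟩
              rwa [h4, hv, one_mul] at h3
            have h3 : (ev k - s) * ‖inner ℝ (w k) d / s‖ ≤ 1 := by
              have h4 := congrArg abs (hcoef k hk)
              rw [abs_mul, abs_neg, abs_of_pos (by linarith)] at h4
              rw [Real.norm_eq_abs, h4]
              exact h2
            rw [le_div_iff₀ hc]
            nlinarith [norm_nonneg (inner ℝ (w k) d / s)]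
          · refine Real.le_sqrt_of_sq_le ?_
            rw [h.norm_sq_adjoint_eigenvector (hk.trans hm)]
            exact h.ev_le hεt (hk.trans hm)
      _ = _ := by simp
  have h1 : √c * ‖W.starProjection d‖ ≤ ‖A' (W.starProjection d)‖ := by
    refine le_of_sq_le_sq ?_ (norm_nonneg _)
    rw [mul_pow, Real.sq_sqrt hc.le]
    exact h.signal_lower _ (Submodule.starProjection_apply_mem _ _)
  have h2 : ‖A' (W.starProjection d)‖ ≤ ε + (√(2 * ε) + ε) + ε * ‖x‖ + ε * ‖x‖ := by
    rw [hPd]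
    refine (norm_sub_le _ _).trans (add_le_add ((norm_add_le _ _).trans (add_le_add
      ((norm_add_le _ _).trans (add_le_add ?_ ?_)) ?_)) (h.noise x))
    · rwa [norm_neg]
    · exact h.norm_nonspiked_part_le hε0 hεt hW hv hvn
    · rw [norm_smul]
      gcongr
      exact hs
  have h3 := mul_le_mul_of_nonneg_left hxn hε0
  linarith

end IsSpikedOperator

/-! ### Contrasts and the centred data matrix -/

/-- The space of contrasts: the vectors in `ℝⁿ` whose coordinates sum to zero. -/
def contrasts (n : ℕ) : Submodule ℝ (EuclideanSpace ℝ (Fin n)) :=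
  (ℝ ∙ WithLp.toLp 2 (fun _ : Fin n => (1 : ℝ)))ᗮ

lemma finrank_contrasts (n : ℕ) (hn : 0 < n) : Module.finrank ℝ (contrasts n) = n - 1 := by
  have h1 := Submodule.finrank_add_finrank_orthogonal
    (ℝ ∙ WithLp.toLp 2 (fun _ : Fin n => (1 : ℝ)))
  have h0 : WithLp.toLp 2 (fun _ : Fin n => (1 : ℝ)) ≠ 0 := by
    intro h
    have := congrArg (fun x : EuclideanSpace ℝ (Fin n) => x ⟨0, hn⟩) h
    simp at this
  rw [finrank_span_singleton h0, finrank_euclideanSpace_fin] at h1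
  change 1 + Module.finrank ℝ (contrasts n) = n at h1
  omega

lemma starProjection_contrasts_apply (n : ℕ) (a : EuclideanSpace ℝ (Fin n)) (i : Fin n) :
    (contrasts n).starProjection a i = a i - (n : ℝ)⁻¹ * ∑ j, a j := by
  have h1 : (contrasts n).starProjection a
      = a - (ℝ ∙ WithLp.toLp 2 (fun _ : Fin n => (1 : ℝ))).starProjection a :=
    Submodule.starProjection_orthogonal_val _
  rw [h1, Submodule.starProjection_singleton, EuclideanSpace.norm_eq]
  simp [PiLp.inner_apply]
  ring

section Data

variable {V : Type*} [NormedAddCommGroup V] [InnerProductSpace ℝ V] {n : ℕ}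

/-- The data matrix with columns `s • y i`, as a linear map. -/
def dataMap (s : ℝ) (y : Fin n → V) : EuclideanSpace ℝ (Fin n) →ₗ[ℝ] V :=
  s • (Fintype.linearCombination ℝ y ∘ₗ (WithLp.linearEquiv 2 ℝ (Fin n → ℝ)).toLinearMap)

/-- The transposed data matrix. -/
def dataAdjoint (s : ℝ) (y : Fin n → V) : V →ₗ[ℝ] EuclideanSpace ℝ (Fin n) :=
  s • ((WithLp.linearEquiv 2 ℝ (Fin n → ℝ)).symm.toLinearMap ∘ₗ
    LinearMap.pi fun i => innerₛₗ ℝ (y i))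

lemma dataMap_apply (s : ℝ) (y : Fin n → V) (a : EuclideanSpace ℝ (Fin n)) :
    dataMap s y a = s • ∑ i, a i • y i := by
  simp [dataMap, Fintype.linearCombination_apply]

lemma dataAdjoint_apply (s : ℝ) (y : Fin n → V) (z : V) (i : Fin n) :
    dataAdjoint s y z i = s * inner ℝ (y i) z := by
  simp [dataAdjoint]

lemma inner_dataMap (s : ℝ) (y : Fin n → V) (a : EuclideanSpace ℝ (Fin n)) (z : V) :
    inner ℝ (dataMap s y a) z = inner ℝ a (dataAdjoint s y z) := by
  rw [dataMap_apply, real_inner_smul_left, sum_inner, PiLp.inner_apply, Finset.mul_sum]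
  refine Finset.sum_congr rfl fun i _ => ?_
  rw [real_inner_smul_left, dataAdjoint_apply]
  simp; ring

/-- The data matrix, restricted to contrasts. -/
def contrastMap (s : ℝ) (y : Fin n → V) : contrasts n →ₗ[ℝ] V :=
  dataMap s y ∘ₗ (contrasts n).subtype

/-- The transposed data matrix, centred. -/
def contrastAdjoint (s : ℝ) (y : Fin n → V) : V →ₗ[ℝ] contrasts n :=
  ((contrasts n).orthogonalProjectionOnto : EuclideanSpace ℝ (Fin n) →ₗ[ℝ] contrasts n) ∘ₗ
    dataAdjoint s y

lemma inner_contrastMap (s : ℝ) (y : Fin n → V) (a : contrasts n) (z : V) :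
    inner ℝ (contrastMap s y a) z = inner ℝ a (contrastAdjoint s y z) := by
  change inner ℝ (dataMap s y a) z
    = inner ℝ a ((contrasts n).orthogonalProjectionOnto (dataAdjoint s y z))
  rw [inner_dataMap, Submodule.inner_orthogonalProjectionOnto_eq_of_mem_left]

lemma coe_contrastAdjoint (s : ℝ) (y : Fin n → V) (z : V) :
    (contrastAdjoint s y z : EuclideanSpace ℝ (Fin n))
      = (contrasts n).starProjection (dataAdjoint s y z) := rfl

lemma norm_contrastAdjoint_le (s : ℝ) (y : Fin n → V) (z : V) :
    ‖contrastAdjoint s y z‖ ≤ ‖dataAdjoint s y z‖ :=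
  (contrasts n).norm_orthogonalProjectionOnto_apply_le _

/-- Differences of coordinates of `dataAdjoint` are contrasts, hence controlled by
`contrastAdjoint`. -/
lemma sq_dataAdjoint_sub_le (s : ℝ) (y : Fin n → V) (z : V) (i j : Fin n) :
    (dataAdjoint s y z i - dataAdjoint s y z j) ^ 2 ≤ 4 * ‖contrastAdjoint s y z‖ ^ 2 := by
  set a := contrastAdjoint s y z with ha
  have h : ∀ i, dataAdjoint s y z i = (a : EuclideanSpace ℝ (Fin n)) i
      + (n : ℝ)⁻¹ * ∑ j, dataAdjoint s y z j := by
    intro i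
    rw [ha, coe_contrastAdjoint, starProjection_contrasts_apply]; ring
  have hle : ∀ i, (a : EuclideanSpace ℝ (Fin n)) i ^ 2 ≤ ‖a‖ ^ 2 := by
    intro i
    have h1 : ‖a‖ ^ 2 = ‖(a : EuclideanSpace ℝ (Fin n))‖ ^ 2 := rfl
    rw [h1, EuclideanSpace.real_norm_sq_eq]
    exact Finset.single_le_sum (f := fun i => (a : EuclideanSpace ℝ (Fin n)) i ^ 2)
      (fun _ _ => sq_nonneg _) (Finset.mem_univ i)
  have h1 := hle i
  have h2 := hle j
  rw [h i, h j]
  nlinarith [sq_nonneg ((a : EuclideanSpace ℝ (Fin n)) i + (a : EuclideanSpace ℝ (Fin n)) j)]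

lemma contrastMap_contrastAdjoint (hn : 0 < n) (s : ℝ) (y : Fin n → V) (z : V) :
    contrastMap s y (contrastAdjoint s y z)
      = s ^ 2 • ∑ i, inner ℝ (y i - (n : ℝ)⁻¹ • ∑ j, y j) z • (y i - (n : ℝ)⁻¹ • ∑ j, y j) := by
  have hn' : (n : ℝ) ≠ 0 := by positivity
  set b := (n : ℝ)⁻¹ • ∑ j, y j with hb
  change dataMap s y (contrastAdjoint s y z : EuclideanSpace ℝ (Fin n)) = _
  rw [dataMap_apply, coe_contrastAdjoint]
  have h1 : ∀ i, (contrasts n).starProjection (dataAdjoint s y z) i = s * inner ℝ (y i - b) z := by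
    intro i
    rw [starProjection_contrasts_apply]
    simp_rw [dataAdjoint_apply]
    rw [← Finset.mul_sum, ← sum_inner, inner_sub_left, hb, real_inner_smul_left]
    ring
  have h2 : ∑ i, inner ℝ (y i - b) z = 0 := by
    rw [← sum_inner, Finset.sum_sub_distrib, hb]
    simp [smul_smul, hn', ← Nat.cast_smul_eq_nsmul ℝ]
  simp_rw [h1, smul_sub]
  rw [Finset.sum_sub_distrib, ← Finset.sum_smul, h2, zero_smul, sub_zero, sq, ← smul_smul]
  congr 1
  rw [Finset.smul_sum]
  exact Finset.sum_congr rfl fun i _ => by rw [smul_smul]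

/-- If the Gram matrix of the noise is entrywise close to `t` times the identity, the noise part of
the data acts on contrasts almost like `√t` times an isometry. -/
lemma norm_noise_le [FiniteDimensional ℝ V] (s : ℝ) (y : Fin n → V) (W : Submodule ℝ V)
    {t δ : ℝ} (hδ : 0 ≤ δ)
    (hT : ∀ i j, |s ^ 2 * inner ℝ (y i - W.starProjection (y i)) (y j - W.starProjection (y j))
      - if i = j then t else 0| ≤ δ) (x : contrasts n) :
    ‖contrastAdjoint s y (contrastMap s y x - W.starProjection (contrastMap s y x)) - t • x‖
      ≤ n * δ * ‖x‖ := by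
  set b : EuclideanSpace ℝ (Fin n) := dataAdjoint s y
    (contrastMap s y x - W.starProjection (contrastMap s y x))
    - t • (x : EuclideanSpace ℝ (Fin n)) with hb
  have h1 : contrastAdjoint s y (contrastMap s y x - W.starProjection (contrastMap s y x)) - t • x
      = (contrasts n).orthogonalProjectionOnto b := by
    rw [hb, ContinuousLinearMap.map_sub, ContinuousLinearMap.map_smul,
      Submodule.orthogonalProjectionOnto_mem_subspace_eq_self]
    rfl
  rw [h1]
  refine ((contrasts n).norm_orthogonalProjectionOnto_apply_le _).trans ?_
  have hx : ∀ j, |(x : EuclideanSpace ℝ (Fin n)) j| ≤ ‖x‖ := fun j =>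
    PiLp.norm_apply_le (x : EuclideanSpace ℝ (Fin n)) j
  have horth : ∀ z z' : V, inner ℝ z (z' - W.starProjection z')
      = inner ℝ (z - W.starProjection z) (z' - W.starProjection z') := by
    intro z z'
    have : inner ℝ (W.starProjection z) (z' - W.starProjection z') = (0 : ℝ) := by
      rw [real_inner_comm]
      exact Submodule.starProjection_inner_eq_zero (K := W) _ _
        (Submodule.starProjection_apply_mem _ _)
    rw [inner_sub_left z, this, sub_zero]
  have hbi : ∀ i, b i = ∑ j, (s ^ 2 * inner ℝ (y i - W.starProjection (y i))
      (y j - W.starProjection (y j)) - if i = j then t else 0)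
        * (x : EuclideanSpace ℝ (Fin n)) j := by
    intro i
    have h2 : contrastMap s y x = s • ∑ j, (x : EuclideanSpace ℝ (Fin n)) j • y j :=
      dataMap_apply _ _ _
    rw [hb, PiLp.sub_apply, dataAdjoint_apply, horth, h2, ← horth, map_smul, map_sum, ← smul_sub,
      ← Finset.sum_sub_distrib, inner_smul_right, inner_sum]
    simp_rw [sub_mul, Finset.sum_sub_distrib, ite_mul, zero_mul]
    rw [Finset.sum_ite_eq Finset.univ i, if_pos (Finset.mem_univ _), Finset.mul_sum,
      Finset.mul_sum]
    congr 1
    refine Finset.sum_congr rfl fun j _ => ?_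
    rw [map_smul, ← smul_sub, inner_smul_right, horth]
    ring
  have hbi' : ∀ i, |b i| ≤ ∑ j, δ * |(x : EuclideanSpace ℝ (Fin n)) j| := by
    intro i
    rw [hbi]
    refine (Finset.abs_sum_le_sum_abs _ _).trans (Finset.sum_le_sum fun j _ => ?_)
    rw [abs_mul]
    gcongr
    exact hT i j
  refine le_of_sq_le_sq ?_ (by positivity)
  rw [EuclideanSpace.real_norm_sq_eq]
  have h3 : (∑ j, |(x : EuclideanSpace ℝ (Fin n)) j|) ^ 2 ≤ n * ‖x‖ ^ 2 := by
    have := sq_sum_le_card_mul_sum_sq (s := Finset.univ)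
      (f := fun j => |(x : EuclideanSpace ℝ (Fin n)) j|)
    simp only [sq_abs, Finset.card_univ, Fintype.card_fin] at this
    rwa [← EuclideanSpace.real_norm_sq_eq] at this
  calc ∑ i, b i ^ 2 ≤ ∑ _i : Fin n, (∑ j, δ * |(x : EuclideanSpace ℝ (Fin n)) j|) ^ 2 := by
        refine Finset.sum_le_sum fun i _ => ?_
        rw [← sq_abs]
        gcongr
        exact hbi' i
    _ = n * (δ ^ 2 * (∑ j, |(x : EuclideanSpace ℝ (Fin n)) j|) ^ 2) := by
        rw [← Finset.mul_sum]; simp [mul_pow]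
    _ ≤ n * (δ ^ 2 * (n * ‖x‖ ^ 2)) := by gcongr
    _ = _ := by ring

lemma norm_contrastAdjoint_le_of_abs_le (s : ℝ) (y : Fin n → V) (z : V) {δ : ℝ} (hδ : 0 ≤ δ)
    (h : ∀ i, |s * inner ℝ (y i) z| ≤ δ) : ‖contrastAdjoint s y z‖ ≤ n * δ := by
  refine (norm_contrastAdjoint_le s y z).trans (le_of_sq_le_sq ?_ (by positivity))
  rw [EuclideanSpace.real_norm_sq_eq]
  calc ∑ i, dataAdjoint s y z i ^ 2 ≤ ∑ _i : Fin n, δ ^ 2 := by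
        refine Finset.sum_le_sum fun i _ => ?_
        rw [dataAdjoint_apply, ← sq_abs]
        gcongr
        exact h i
    _ = n * δ ^ 2 := by simp
    _ ≤ n * n * δ ^ 2 := by
        rcases Nat.eq_zero_or_pos n with rfl | hn
        · simp
        · have : (1 : ℝ) ≤ n := by exact_mod_cast hn
          gcongr
          nlinarith
    _ = _ := by ring

end Data

/-! ### The sample covariance as a Gram operator -/

section Matrices

variable {n p : ℕ}

lemma outerSelf_mulVec (x y : EuclideanSpace ℝ (Fin p)) :
    (outerSelf x).mulVec y.ofLp = inner ℝ x y • x.ofLp := by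
  ext i
  simp only [outerSelf, Matrix.mulVec, dotProduct, Matrix.vecMulVec_apply, PiLp.inner_apply,
    Pi.smul_apply, smul_eq_mul, RCLike.inner_apply, conj_trivial, Finset.sum_mul]
  exact Finset.sum_congr rfl fun j _ => by ring

lemma sum_outerSelf_mulVec {ι : Type*} (s : Finset ι) (a : ι → ℝ)
    (w : ι → EuclideanSpace ℝ (Fin p)) (y : EuclideanSpace ℝ (Fin p)) :
    WithLp.toLp 2 ((∑ k ∈ s, a k • outerSelf (w k)).mulVec y.ofLp)
      = ∑ k ∈ s, (a k * inner ℝ (w k) y) • w k := by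
  rw [Matrix.sum_mulVec, WithLp.toLp_sum]
  refine Finset.sum_congr rfl fun k _ => ?_
  rw [Matrix.smul_mulVec, outerSelf_mulVec, smul_smul]
  rfl

lemma ridgedMatrix_mulVec (n m : ℕ) (ev : ℕ → ℝ) (w : ℕ → EuclideanSpace ℝ (Fin p))
    (y : EuclideanSpace ℝ (Fin p)) :
    WithLp.toLp 2 ((ridgedMatrix n m ev w).mulVec y.ofLp)
      = ∑ k ∈ Finset.range m, (ev k * inner ℝ (w k) y) • w k - nonspikedAverage n m ev • y := by
  rw [ridgedMatrix, Matrix.sub_mulVec, WithLp.toLp_sub, spikedPart, sum_outerSelf_mulVec,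
    Matrix.smul_mulVec, Matrix.one_mulVec]
  rfl

lemma sum_inner_centered_smul (hn : 0 < n) {x : Fin n → EuclideanSpace ℝ (Fin p)}
    {N : ℕ} {ev : ℕ → ℝ} {w : ℕ → EuclideanSpace ℝ (Fin p)}
    (h : IsOrderedEigendecomposition N (sampleCov x) ev w) (z : EuclideanSpace ℝ (Fin p)) :
    ∑ i, inner ℝ (x i - sampleMean x) z • (x i - sampleMean x)
      = (n : ℝ) • ∑ k ∈ Finset.range N, (ev k * inner ℝ (w k) z) • w k := by
  have hn' : (n : ℝ) ≠ 0 := by positivity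
  rw [← sum_outerSelf_mulVec, ← h.eq_sum, sampleCov, Matrix.smul_mulVec, WithLp.toLp_smul,
    smul_smul, mul_inv_cancel₀ hn', one_smul]
  have := sum_outerSelf_mulVec Finset.univ (fun _ : Fin n => (1 : ℝ))
    (fun i => x i - sampleMean x) z
  simp only [one_smul, one_mul] at this
  rw [this]

/-- The centred data as a spiked operator. -/
lemma isSpikedOperator_contrastMap (hn : 0 < n) (hp : 0 < p)
    {x : Fin n → EuclideanSpace ℝ (Fin p)} (b : EuclideanSpace ℝ (Fin p))
    {ev : ℕ → ℝ} {w : ℕ → EuclideanSpace ℝ (Fin p)}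
    (h : IsOrderedEigendecomposition (n - 1) (sampleCov x) ev w)
    (W : Submodule ℝ (EuclideanSpace ℝ (Fin p))) {t δ c M : ℝ} (hδ : 0 ≤ δ) (hM : 0 ≤ M)
    (hT : ∀ i j, |(√(p : ℝ))⁻¹ ^ 2 * inner ℝ ((x i - b) - W.starProjection (x i - b))
      ((x j - b) - W.starProjection (x j - b)) - if i = j then t else 0| ≤ δ)
    (hl : ∀ y ∈ W, c * ‖y‖ ^ 2 ≤ ‖contrastAdjoint (√(p : ℝ))⁻¹ (fun i => x i - b) y‖ ^ 2)
    (hu : ∀ y ∈ W, ‖contrastAdjoint (√(p : ℝ))⁻¹ (fun i => x i - b) y‖ ^ 2 ≤ M * ‖y‖ ^ 2) :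
    IsSpikedOperator (contrastMap (√(p : ℝ))⁻¹ fun i => x i - b)
      (contrastAdjoint (√(p : ℝ))⁻¹ fun i => x i - b) W (n - 1) (fun k => n / p * ev k) w t (n * δ)
      c M where
  adjoint := inner_contrastMap _ _
  orthonormal := h.orthonormal
  antitone k l hkl hl := by
    have := h.antitone k l hkl hl
    gcongr
  nonneg := hM
  gram y := by
    have hn' : (n : ℝ) ≠ 0 := by positivity
    have h1 : ∀ i, x i - b - (n : ℝ)⁻¹ • ∑ j, (x j - b) = x i - sampleMean x := by
      intro i
      rw [Finset.sum_sub_distrib, smul_sub, sampleMean]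
      simp [← Nat.cast_smul_eq_nsmul ℝ, smul_smul, hn']
    rw [contrastMap_contrastAdjoint hn]
    simp_rw [h1]
    rw [sum_inner_centered_smul hn h, smul_smul, Finset.smul_sum, inv_pow,
      Real.sq_sqrt (by positivity)]
    refine Finset.sum_congr rfl fun k _ => ?_
    rw [smul_smul]
    congr 1
    ring
  finrank_eq := finrank_contrasts n hn
  noise := norm_noise_le _ _ W hδ hT
  signal_lower := hl
  signal_upper := hu

end Matrices

/-! ### Almost orthogonality of the ridged vector, uniformly in the dimension -/

/-- Vectors with a small cosine are almost orthogonal, uniformly over all spaces. -/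
lemma exists_abs_angle_sub_pi_div_two_lt {η : ℝ} (hη : 0 < η) :
    ∃ ρ > 0, ∀ {V : Type} [NormedAddCommGroup V] [InnerProductSpace ℝ V] (x y : V),
      |inner ℝ x y| < ρ * (‖x‖ * ‖y‖) →
        |InnerProductGeometry.angle x y - Real.pi / 2| < η := by
  have h : Tendsto Real.arccos (𝓝 0) (𝓝 (Real.pi / 2)) := by
    have := Real.continuous_arccos.tendsto 0
    rwa [Real.arccos_zero] at this
  obtain ⟨ρ, hρ, hh⟩ := Metric.tendsto_nhds_nhds.1 h η hη
  refine ⟨ρ, hρ, fun {V} _ _ x y hxy => ?_⟩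
  have hpos : 0 < ‖x‖ * ‖y‖ := by
    rcases (by positivity : 0 ≤ ‖x‖ * ‖y‖).eq_or_lt with h0 | h0
    · rw [← h0, mul_zero] at hxy
      exact absurd hxy (not_lt.2 (abs_nonneg _))
    · exact h0
  refine hh ?_
  rwa [Real.dist_eq, sub_zero, abs_div, abs_of_pos hpos, div_lt_iff₀ hpos]

namespace IsSpikedOperator

variable {H : Type*} [NormedAddCommGroup H] [InnerProductSpace ℝ H] {n m p : ℕ}
  {A : H →ₗ[ℝ] EuclideanSpace ℝ (Fin p)} {A' : EuclideanSpace ℝ (Fin p) →ₗ[ℝ] H}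
  {W : Submodule ℝ (EuclideanSpace ℝ (Fin p))} {ev : ℕ → ℝ} {w : ℕ → EuclideanSpace ℝ (Fin p)}
  {κ t ε c M : ℝ}

lemma abs_nonspikedAverage_sub_le
    (h : IsSpikedOperator A A' W (n - 1) (fun k => κ * ev k) w t ε c M)
    (hmn : m + 2 ≤ n) (hε : ε < t) (hW : Module.finrank ℝ W = m) :
    |κ * nonspikedAverage n m ev - t| ≤ ε := by
  have h1 := h.abs_average_sub_le hε hW (by omega)
  rwa [← Finset.mul_sum, Nat.cast_sub (by omega), Nat.cast_one, mul_div_assoc,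
    sub_right_comm] at h1

/-- Multiplying the eigenvalues by `κ` multiplies the ridged matrix by `κ`. -/
lemma smul_ridgedMatrix_mulVec (κ : ℝ) (ev : ℕ → ℝ) (w : ℕ → EuclideanSpace ℝ (Fin p))
    (d : EuclideanSpace ℝ (Fin p)) :
    κ • WithLp.toLp 2 ((ridgedMatrix n m ev w).mulVec d.ofLp)
      = ∑ k ∈ Finset.range m, (κ * ev k * inner ℝ (w k) d) • w k
        - (κ * nonspikedAverage n m ev) • d := by
  rw [ridgedMatrix_mulVec, smul_sub, Finset.smul_sum, smul_smul]
  congr 1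
  exact Finset.sum_congr rfl fun k _ => by rw [smul_smul, mul_assoc]

lemma isUnit_ridgedMatrix (h : IsSpikedOperator A A' W (n - 1) (fun k => κ * ev k) w t ε c M)
    (hmn : m + 2 ≤ n) (hε : ε < t) (hc : 0 < c) (hεc : 4 * ε ≤ c)
    (hW : Module.finrank ℝ W = m) : IsUnit (ridgedMatrix n m ev w) := by
  have hs := abs_le.1 (h.abs_nonspikedAverage_sub_le hmn hε hW)
  rw [← Matrix.mulVec_injective_iff_isUnit]
  have hinj : Function.Injective (ridgedMatrix n m ev w).mulVecLin := by
    rw [injective_iff_map_eq_zero]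
    intro d hd
    have h1 := smul_ridgedMatrix_mulVec (n := n) (m := m) κ ev w (WithLp.toLp 2 d)
    have h2 : (ridgedMatrix n m ev w).mulVec d = 0 := hd
    rw [h2] at h1
    have h3 : WithLp.toLp 2 d = 0 := by
      refine h.eq_zero_of_ridged_eq_zero (m := m) (s := κ * nonspikedAverage n m ev) (by omega)
        (by linarith : (0 : ℝ) < _).ne' (fun k hk => ?_) (by rw [← h1]; simp)
      have := h.le_ev_of_spiked hc (by omega : k < n - 1) (hW ▸ hk)
      exact ne_of_gt (by linarith)
    simpa using h3
  exact hinj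

lemma ridgedVector_eq (hu : IsUnit (ridgedMatrix n m ev w)) (κ : ℝ)
    (v : EuclideanSpace ℝ (Fin p)) :
    ∑ k ∈ Finset.range m, (κ * ev k * inner ℝ (w k) (ridgedVector n m ev w v)) • w k
      - (κ * nonspikedAverage n m ev) • ridgedVector n m ev w v
      = -((κ * nonspikedAverage n m ev) • v) := by
  rw [← smul_ridgedMatrix_mulVec, ridgedVector]
  simp only [Matrix.mulVec_smul, Matrix.mulVec_mulVec]
  rw [Matrix.mul_nonsing_inv _ ((Matrix.isUnit_iff_isUnit_det _).1 hu), Matrix.one_mulVec,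
    WithLp.toLp_smul, smul_smul, ← neg_smul]
  simp

/-- The deterministic core: if the noise level `ε` is small enough, in terms of bounds that do not
involve the dimension, then the ridged vector exists and is almost orthogonal to the signal
space. -/
lemma exists_noise_threshold (m : ℕ) {t c M η : ℝ} (ht : 0 < t) (hc : 0 < c) (hM : 0 ≤ M)
    (hη : 0 < η) :
    ∃ ε₀ > 0, ∀ ε, 0 ≤ ε → ε ≤ ε₀ → ∀ {H : Type} [NormedAddCommGroup H] [InnerProductSpace ℝ H]
      {n p : ℕ} {A : H →ₗ[ℝ] EuclideanSpace ℝ (Fin p)} {A' : EuclideanSpace ℝ (Fin p) →ₗ[ℝ] H}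
      {W : Submodule ℝ (EuclideanSpace ℝ (Fin p))} {ev : ℕ → ℝ}
      {w : ℕ → EuclideanSpace ℝ (Fin p)} {κ : ℝ} {v : EuclideanSpace ℝ (Fin p)},
      m + 2 ≤ n → IsSpikedOperator A A' W (n - 1) (fun k => κ * ev k) w t ε c M →
      Module.finrank ℝ W = m → ‖v‖ = 1 → ‖A' (v - W.starProjection v)‖ ≤ ε →
      IsUnit (ridgedMatrix n m ev w) ∧ ridgedVector n m ev w v ≠ 0 ∧
        ‖W.starProjection (ridgedVector n m ev w v)‖ < η * ‖ridgedVector n m ev w v‖ := by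
  set f : ℝ → ℝ := fun ε =>
    √(2 * ε) + 2 * ε + 2 * ε * (m * (2 / c * √(M + t + ε))) with hf
  set g : ℝ → ℝ := fun ε => √c * (η * ((t - ε) / (M + t + ε + (t + ε)))) with hg
  have h1 : ∀ᶠ ε in 𝓝 (0 : ℝ), f ε < g ε := by
    have hfc : ContinuousAt f 0 := by fun_prop
    have hgc : ContinuousAt g 0 := by
      have h0 : M + t + 0 + (t + 0) ≠ 0 := by positivity
      have h2 : ContinuousAt (fun ε : ℝ => (t - ε) / (M + t + ε + (t + ε))) 0 :=
        ContinuousAt.div (by fun_prop) (by fun_prop) h0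
      exact continuousAt_const.mul (continuousAt_const.mul h2)
    refine hfc.eventually_lt hgc ?_
    have hf0 : f 0 = 0 := by simp [hf]
    rw [hf0]
    simp only [hg, sub_zero, add_zero]
    positivity
  obtain ⟨ε₁, hε₁, hfg⟩ := Metric.eventually_nhds_iff.1 h1
  refine ⟨min (ε₁ / 2) (min (t / 2) (c / 4)), by positivity, ?_⟩
  intro ε hε0 hε H _ _ n p A A' W ev w κ v hmn h hW hv hvn
  have hε1 : ε < ε₁ := by
    have := hε.trans (min_le_left _ _)
    linarith
  have hεt : ε < t := by
    have := hε.trans ((min_le_right _ _).trans (min_le_left _ _))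
    linarith
  have hεc : 4 * ε ≤ c := by
    have := hε.trans ((min_le_right _ _).trans (min_le_right _ _))
    linarith
  have hu := h.isUnit_ridgedMatrix hmn hεt hc hεc hW
  set s := κ * nonspikedAverage n m ev with hs
  have hst := h.abs_nonspikedAverage_sub_le hmn hεt hW
  have hst' := abs_le.1 hst
  have hs0 : 0 < s := by linarith
  have hd := ridgedVector_eq hu κ v
  have h2 := h.norm_starProjection_le_of_ridged_eq hc hε0 hεt hεc hW (by omega) hs0 hst hv hvn hd
  have h3 := h.le_norm_of_ridged_eq (by omega : m ≤ n - 1) hs0 (K := M + t + ε) (by positivity)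
    (fun k hk => h.ev_le hεt (by omega)) hv hd
  have h4 : (t - ε) / (M + t + ε + (t + ε)) ≤ ‖ridgedVector n m ev w v‖ := by
    refine le_trans ?_ h3
    have : 0 ≤ t - ε := by linarith
    gcongr <;> linarith
  refine ⟨hu, ?_, ?_⟩
  · rw [← norm_pos_iff]
    refine lt_of_lt_of_le ?_ h4
    have : 0 < t - ε := by linarith
    positivity
  · have h5 : f ε < g ε := hfg (by rwa [Real.dist_eq, sub_zero, abs_of_nonneg hε0])
    have h6 : √c * ‖W.starProjection (ridgedVector n m ev w v)‖
        < √c * (η * ‖ridgedVector n m ev w v‖) := by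
      refine (h2.trans_lt h5).trans_le ?_
      simp only [hg]
      gcongr
    exact lt_of_mul_lt_mul_left h6 (Real.sqrt_nonneg c)

end IsSpikedOperator

/-! ### General position of the leading scores -/

section GeneralPosition

variable {Ω : Type*} [MeasurableSpace Ω] {P : Measure Ω}
  {V : Type*} [NormedAddCommGroup V] [NormedSpace ℝ V] [FiniteDimensional ℝ V]
  [MeasurableSpace V] [BorelSpace V] {m : ℕ}

/-- A proper affine subspace, given as the preimage of a subspace, is a null set. -/
lemma measure_setOf_sub_mem_eq_zero (μ : Measure V) [μ.IsAddHaarMeasure]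
    {L : V →ₗ[ℝ] (Fin m → ℝ)} (hL : Function.Surjective L) (S : Submodule ℝ (Fin m → ℝ))
    (hS : S ≠ ⊤) (b : Fin m → ℝ) : μ {x | L x - b ∈ S} = 0 := by
  obtain ⟨z, rfl⟩ := hL b
  have h1 : {x | L x - L z ∈ S} = (fun x => x + -z) ⁻¹' (S.comap L : Set V) := by
    ext x; simp [sub_eq_add_neg]
  rw [h1, measure_preimage_add_right]
  refine Measure.addHaar_submodule μ _ fun h => hS ?_
  rw [← Submodule.map_comap_eq_of_surjective hL S, h, Submodule.map_top,
    LinearMap.range_eq_top.2 hL]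

/-- An independent, absolutely continuous observation almost surely avoids the span of fewer than
`m` vectors that depend on the other observations. -/
lemma ae_linearIndependent_snoc [IsProbabilityMeasure P] (μ : Measure V) [μ.IsAddHaarMeasure]
    {E : Type*} [MeasurableSpace E] {Y : Ω → E} {U : Ω → V} (hY : Measurable Y)
    (hU : Measurable U) (hYU : IndepFun Y U P) (hac : P.map U ≪ μ)
    {L : V →ₗ[ℝ] (Fin m → ℝ)} (hL : Function.Surjective L) {j : ℕ} (hj : j < m)
    {D : E → Fin j → Fin m → ℝ} (hD : Measurable D) {b : E → Fin m → ℝ} (hb : Measurable b)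
    (hind : ∀ᵐ ω ∂P, LinearIndependent ℝ (D (Y ω))) :
    ∀ᵐ ω ∂P, LinearIndependent ℝ
      (Fin.snoc (D (Y ω)) (L (U ω) - b (Y ω)) : Fin (j + 1) → Fin m → ℝ) := by
  have hLm : Measurable L := (LinearMap.continuous_of_finiteDimensional L).measurable
  set bad : Set (E × V) := {q | LinearIndependent ℝ (D q.1)} ∩
    {q | LinearIndependent ℝ (Fin.snoc (D q.1) (L q.2 - b q.1) : Fin (j + 1) → Fin m → ℝ)}ᶜ
    with hbad
  have hm1 : MeasurableSet {q : E × V | LinearIndependent ℝ (D q.1)} :=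
    (hD.comp measurable_fst) isOpen_setOfPred_linearIndependent.measurableSet
  have hsnoc : Measurable fun q : E × V =>
      (Fin.snoc (D q.1) (L q.2 - b q.1) : Fin (j + 1) → Fin m → ℝ) := by
    refine measurable_pi_lambda _ fun i => ?_
    refine Fin.lastCases ?_ (fun i => ?_) i
    · simp only [Fin.snoc_last]
      exact (hLm.comp measurable_snd).sub (hb.comp measurable_fst)
    · simp only [Fin.snoc_castSucc]
      exact (measurable_pi_apply i).comp (hD.comp measurable_fst)
  have hm2 : MeasurableSet bad :=
    hm1.inter (hsnoc isOpen_setOfPred_linearIndependent.measurableSet).compl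
  have hnull : P.map (fun ω => (Y ω, U ω)) bad = 0 := by
    rw [hYU.map_prod_eq_prod_map_map hY.aemeasurable hU.aemeasurable, Measure.measure_prod_null hm2]
    refine ae_of_all _ fun y => ?_
    by_cases hy : LinearIndependent ℝ (D y)
    · refine measure_mono_null ?_ (hac (measure_setOf_sub_mem_eq_zero μ hL
        (Submodule.span ℝ (Set.range (D y))) ?_ (b y)))
      · rintro x ⟨-, hx⟩
        by_contra hcon
        exact hx (linearIndependent_finSnoc.2 ⟨hy, hcon⟩)
      · intro htop
        have h1 := finrank_range_le_card (R := ℝ) (D y)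
        rw [Set.finrank, htop, finrank_top, Module.finrank_fin_fun, Fintype.card_fin] at h1
        omega
    · have : Prod.mk y ⁻¹' bad = ∅ := by
        ext x; simp [hbad, hy]
      simp [this]
  rw [Measure.map_apply (hY.prodMk hU) hm2] at hnull
  have h2 : ∀ᵐ ω ∂P, ω ∉ (fun ω => (Y ω, U ω)) ⁻¹' bad := measure_eq_zero_iff_ae_notMem.1 hnull
  filter_upwards [hind, h2] with ω h3 h4
  by_contra hcon
  exact h4 ⟨h3, hcon⟩

/-- `m + 1` independent random vectors with absolutely continuous distributions, seen through a
linear surjection onto `ℝᵐ`, are almost surely in general position. -/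
lemma ae_linearIndependent_sub [IsProbabilityMeasure P] (μ : Measure V) [μ.IsAddHaarMeasure]
    {X : Fin (m + 1) → Ω → V} (hX : ∀ i, Measurable (X i)) (hind : iIndepFun X P)
    (hac : ∀ i, P.map (X i) ≪ μ) {L : V →ₗ[ℝ] (Fin m → ℝ)} (hL : Function.Surjective L) :
    ∀ᵐ ω ∂P, LinearIndependent ℝ (fun i : Fin m => L (X i.succ ω) - L (X 0 ω)) := by
  have hLm : Measurable L := (LinearMap.continuous_of_finiteDimensional L).measurable
  suffices H : ∀ j (hj : j ≤ m), ∀ᵐ ω ∂P, LinearIndependent ℝ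
      (fun i : Fin j => L (X (Fin.castLE hj i).succ ω) - L (X 0 ω)) by
    simpa using H m le_rfl
  intro j
  induction j with
  | zero => exact fun _ => ae_of_all _ fun ω => linearIndependent_empty_type
  | succ j ih =>
    intro hj
    set a : Fin (m + 1) := (⟨j, hj⟩ : Fin m).succ with ha
    set S : Finset (Fin (m + 1)) := Finset.univ.filter fun i => (i : ℕ) < j + 1 with hS
    have hdisj : Disjoint S {a} := by
      rw [Finset.disjoint_singleton_right, hS]
      simp [ha]
    have hYU := hind.indepFun_finset S {a} hdisj hX
    have hpi : Measurable fun f : ({a} : Finset (Fin (m + 1))) → V =>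
        f ⟨a, Finset.mem_singleton_self a⟩ := measurable_pi_apply _
    have hYU' : IndepFun (fun ω (i : S) => X i ω) (X a) P := hYU.comp measurable_id hpi
    have h0 : (0 : Fin (m + 1)) ∈ S := by simp [hS]
    have hmem : ∀ i : Fin j, (Fin.castLE (Nat.le_of_succ_le hj) i).succ ∈ S := by
      intro i; simp [hS]
    have h1 := ae_linearIndependent_snoc μ (Y := fun ω (i : S) => X i ω)
      (measurable_pi_lambda _ fun i => hX i) (hX a) hYU' (hac a) hL hj
      (D := fun y i => L (y ⟨_, hmem i⟩) - L (y ⟨0, h0⟩)) (b := fun y => L (y ⟨0, h0⟩))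
      (measurable_pi_lambda _ fun i => (hLm.comp (measurable_pi_apply _)).sub
        (hLm.comp (measurable_pi_apply _)))
      (hLm.comp (measurable_pi_apply _)) (ih (Nat.le_of_succ_le hj))
    filter_upwards [h1] with ω hω
    convert! hω using 1
    funext i
    refine Fin.lastCases ?_ (fun i => ?_) i
    · rw [Fin.snoc_last]; rfl
    · rw [Fin.snoc_castSucc]; rfl

end GeneralPosition

section InverseBound

variable {m : ℕ}

/-- The sum of the squared entries of the inverse of a square matrix. -/
def sumSqInv (q : Fin m → Fin m → ℝ) : ℝ := ∑ i, ∑ j, (Matrix.of q)⁻¹ i j ^ 2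

lemma measurable_sumSqInv : Measurable (sumSqInv (m := m)) := by
  have hc : Continuous fun q : Fin m → Fin m → ℝ => Matrix.of q := continuous_id
  refine Finset.measurable_sum _ fun i _ => Finset.measurable_sum _ fun j _ => ?_
  simp only [Matrix.inv_def, Matrix.smul_apply, smul_eq_mul, Ring.inverse_eq_inv']
  refine Measurable.pow_const (Measurable.mul ?_ ?_) 2
  · exact hc.matrix_det.measurable.inv
  · exact (hc.matrix_adjugate.matrix_elem i j).measurable

lemma sum_sq_le_sumSqInv_mul {q : Fin m → Fin m → ℝ} (hq : IsUnit (Matrix.of q)) (b : Fin m → ℝ) :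
    ∑ k, b k ^ 2 ≤ sumSqInv q * ∑ i, (∑ k, q i k * b k) ^ 2 := by
  have h1 : b = ((Matrix.of q)⁻¹).mulVec ((Matrix.of q).mulVec b) := by
    rw [Matrix.mulVec_mulVec, Matrix.nonsing_inv_mul _ ((Matrix.isUnit_iff_isUnit_det _).1 hq),
      Matrix.one_mulVec]
  have h2 : ∀ i, ((Matrix.of q).mulVec b) i = ∑ k, q i k * b k := fun i => rfl
  simp_rw [← h2]
  rw [sumSqInv, Finset.sum_mul]
  refine Finset.sum_le_sum fun k _ => ?_
  have h3 : b k = ∑ i, (Matrix.of q)⁻¹ k i * (Matrix.of q).mulVec b i := congrFun h1 k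
  rw [h3]
  exact Finset.sum_mul_sq_le_sq_mul_sq _ _ _

end InverseBound

/-- A real random variable is tight. -/
lemma exists_measure_lt_le {Ω : Type*} [MeasurableSpace Ω] {P : Measure Ω} [IsProbabilityMeasure P]
    {f : Ω → ℝ} (hf : Measurable f) {θ : ENNReal} (hθ : 0 < θ) :
    ∃ N : ℝ, 0 < N ∧ P {ω | N < f ω} ≤ θ := by
  have h1 : Tendsto (P ∘ fun k : ℕ => {ω | (k : ℝ) < f ω}) atTop
      (𝓝 (P (⋂ k : ℕ, {ω | (k : ℝ) < f ω}))) := by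
    refine tendsto_measure_iInter_atTop
      (fun k => (measurableSet_lt measurable_const hf).nullMeasurableSet) ?_
      ⟨0, measure_ne_top _ _⟩
    intro k l hkl ω hω
    have : (k : ℝ) ≤ l := by exact_mod_cast hkl
    exact lt_of_le_of_lt this hω
  have h2 : (⋂ k : ℕ, {ω | (k : ℝ) < f ω}) = ∅ := by
    ext ω
    simp only [Set.mem_iInter, Set.mem_ofPred_eq, Set.mem_empty_iff_false, iff_false, not_forall,
      not_lt]
    exact exists_nat_ge _
  rw [h2, measure_empty] at h1
  obtain ⟨k, hk, hk0⟩ := ((h1.eventually (gt_mem_nhds hθ)).and (eventually_gt_atTop 0)).exists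
  exact ⟨k, by exact_mod_cast hk0, hk.le⟩

/-! ### Maximal correlation and mixing -/

section Mixing

variable {Ω : Type*} {A B mΩ : MeasurableSpace Ω} {P : Measure Ω}

lemma abs_integral_mul_le_sqrt_mul_sqrt {f g : Ω → ℝ} (hf : MemLp f 2 P) (hg : MemLp g 2 P) :
    |∫ ω, f ω * g ω ∂P| ≤ √(∫ ω, f ω ^ 2 ∂P) * √(∫ ω, g ω ^ 2 ∂P) := by
  have hin : ∀ {f g : Ω → ℝ} (hf : MemLp f 2 P) (hg : MemLp g 2 P),
      inner ℝ (hf.toLp f) (hg.toLp g) = ∫ ω, f ω * g ω ∂P := by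
    intro f g hf hg
    rw [L2.inner_def]
    refine integral_congr_ae ?_
    filter_upwards [hf.coeFn_toLp, hg.coeFn_toLp] with ω h1 h2
    rw [h1, h2]
    simp [mul_comm]
  have hnorm : ∀ {f : Ω → ℝ} (hf : MemLp f 2 P), ‖hf.toLp f‖ = √(∫ ω, f ω ^ 2 ∂P) := by
    intro f hf
    rw [norm_eq_sqrt_real_inner, hin hf hf]
    simp only [sq]
  rw [← hin hf hg, ← hnorm hf, ← hnorm hg]
  exact abs_real_inner_le_norm _ _

lemma abs_covariance_le_sqrt_mul_sqrt [IsProbabilityMeasure P] {f g : Ω → ℝ} (hf : MemLp f 2 P)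
    (hg : MemLp g 2 P) : |cov[f, g; P]| ≤ √(Var[f; P]) * √(Var[g; P]) := by
  rw [variance_eq_integral hf.aestronglyMeasurable.aemeasurable,
    variance_eq_integral hg.aestronglyMeasurable.aemeasurable]
  exact abs_integral_mul_le_sqrt_mul_sqrt (hf.sub (memLp_const _)) (hg.sub (memLp_const _))

/-- The set whose supremum is the maximal correlation is bounded by one. -/
lemma correlation_le_one [IsProbabilityMeasure P] :
    ∀ c ∈ {c : ℝ | ∃ f g : Ω → ℝ, Measurable[A] f ∧ Measurable[B] g ∧ MemLp f 2 P ∧ MemLp g 2 P ∧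
      c = |cov[f, g; P]| / (√(Var[f; P]) * √(Var[g; P]))}, c ≤ 1 := by
  rintro c ⟨f, g, -, -, hf, hg, rfl⟩
  exact div_le_one_of_le₀ (abs_covariance_le_sqrt_mul_sqrt hf hg) (by positivity)

lemma maximalCorrelation_nonneg : 0 ≤ maximalCorrelation P A B := by
  refine Real.sSup_nonneg ?_
  rintro c ⟨f, g, -, -, -, -, rfl⟩
  positivity

lemma maximalCorrelation_le_one [IsProbabilityMeasure P] :
    maximalCorrelation P A B ≤ 1 :=
  Real.sSup_le (correlation_le_one) zero_le_one

lemma abs_covariance_le_maximalCorrelation_mul [IsProbabilityMeasure P]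
    {f g : Ω → ℝ} (hfA : Measurable[A] f) (hgB : Measurable[B] g) (hf : MemLp f 2 P)
    (hg : MemLp g 2 P) :
    |cov[f, g; P]| ≤ maximalCorrelation P A B * (√(Var[f; P]) * √(Var[g; P])) := by
  have hCS := abs_covariance_le_sqrt_mul_sqrt hf hg
  rcases (by positivity : 0 ≤ √(Var[f; P]) * √(Var[g; P])).eq_or_lt with h0 | h0
  · rw [← h0] at hCS ⊢
    simpa using hCS
  · rw [← div_le_iff₀ h0]
    exact le_csSup ⟨1, correlation_le_one⟩ ⟨f, g, hfA, hgB, hf, hg, rfl⟩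

lemma rhoMixingCoeff_nonneg (ξ : ℕ → Ω → ℝ) (l : ℕ) : 0 ≤ rhoMixingCoeff P ξ l :=
  Real.iSup_nonneg fun _ => maximalCorrelation_nonneg

lemma rhoMixingCoeff_le_one [IsProbabilityMeasure P] (ξ : ℕ → Ω → ℝ) (l : ℕ) :
    rhoMixingCoeff P ξ l ≤ 1 :=
  Real.iSup_le (fun _ => maximalCorrelation_le_one) zero_le_one

/-- Square-integrable functions of two terms of a `ρ`-mixing sequence that are `l` apart have
correlation at most `ρ l`. -/
lemma abs_covariance_comp_le_rhoMixingCoeff_mul [IsProbabilityMeasure P] (ξ : ℕ → Ω → ℝ)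
    {φ : ℝ → ℝ} (hφ : Measurable φ) (a b : ℕ) (ha : MemLp (fun ω => φ (ξ a ω)) 2 P)
    (hb : MemLp (fun ω => φ (ξ b ω)) 2 P) :
    |cov[fun ω => φ (ξ a ω), fun ω => φ (ξ b ω); P]| ≤ rhoMixingCoeff P ξ (Nat.dist a b) *
      (√(Var[fun ω => φ (ξ a ω); P]) * √(Var[fun ω => φ (ξ b ω); P])) := by
  wlog hab : a ≤ b generalizing a b
  · rw [covariance_comm, Nat.dist_comm, mul_comm (√_)]
    exact this b a hb ha (le_of_not_ge hab)
  rw [Nat.dist_eq_sub_of_le hab]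
  have hA : Measurable[⨆ k : {k : ℕ // k ≤ a}, MeasurableSpace.comap (ξ k) inferInstance]
      (fun ω => φ (ξ a ω)) := by
    have h1 : Measurable[MeasurableSpace.comap (ξ a) inferInstance] (fun ω => φ (ξ a ω)) :=
      hφ.comp (comap_measurable _)
    exact h1.mono (le_iSup (fun k : {k : ℕ // k ≤ a} =>
      MeasurableSpace.comap (ξ k) inferInstance) ⟨a, le_rfl⟩) le_rfl
  have hB : Measurable[⨆ k : {k : ℕ // a + (b - a) ≤ k},
      MeasurableSpace.comap (ξ k) inferInstance] (fun ω => φ (ξ b ω)) := by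
    have h1 : Measurable[MeasurableSpace.comap (ξ b) inferInstance] (fun ω => φ (ξ b ω)) :=
      hφ.comp (comap_measurable _)
    exact h1.mono (le_iSup (fun k : {k : ℕ // a + (b - a) ≤ k} =>
      MeasurableSpace.comap (ξ k) inferInstance) ⟨b, by omega⟩) le_rfl
  refine (abs_covariance_le_maximalCorrelation_mul hA hB ha hb).trans ?_
  gcongr
  exact le_ciSup (f := fun j => maximalCorrelation P
    (⨆ k : {k : ℕ // k ≤ j}, MeasurableSpace.comap (ξ k) inferInstance)
    (⨆ k : {k : ℕ // j + (b - a) ≤ k}, MeasurableSpace.comap (ξ k) inferInstance))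
    ⟨1, by rintro _ ⟨j, rfl⟩; exact maximalCorrelation_le_one⟩ a

/-- If `r` tends to zero, so do the averages of `r |σ k - σ l|` over the pairs `k, l < p`, for any
enumeration `σ` without repetitions: few indices are close to a given one. -/
lemma tendsto_average_dist {r : ℕ → ℝ} (hr0 : ∀ l, 0 ≤ r l) (hr1 : ∀ l, r l ≤ 1)
    (hr : Tendsto r atTop (𝓝 0)) {σ : ℕ → ℕ} (hσ : Function.Injective σ) :
    Tendsto (fun p : ℕ => (∑ k ∈ Finset.range p, ∑ l ∈ Finset.range p, r (Nat.dist (σ k) (σ l)))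
      / (p : ℝ) ^ 2) atTop (𝓝 0) := by
  rw [Metric.tendsto_atTop]
  intro ε hε
  obtain ⟨L, hL⟩ := Filter.eventually_atTop.1 (hr.eventually (gt_mem_nhds (half_pos hε)))
  obtain ⟨p₀, hp₀⟩ := exists_nat_gt (4 * (L : ℝ) / ε)
  refine ⟨p₀ + 1, fun p hp => ?_⟩
  have hp0 : (0 : ℝ) < p := by
    have : 0 < p := by omega
    exact_mod_cast this
  have hrow : ∀ k, ∑ l ∈ Finset.range p, r (Nat.dist (σ k) (σ l)) ≤ 2 * L + p * (ε / 2) := by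
    intro k
    have hcard : ((Finset.range p).filter fun l => Nat.dist (σ k) (σ l) < L).card ≤ 2 * L := by
      calc _ ≤ (Finset.Ico (σ k - L) (σ k + L)).card := by
            refine Finset.card_le_card_of_injOn σ ?_ hσ.injOn
            intro l hl
            have := (Finset.mem_filter.1 hl).2
            simp only [Nat.dist] at this
            simp only [Finset.coe_Ico, Set.mem_Ico]
            omega
        _ ≤ _ := by rw [Nat.card_Ico]; omega
    calc _ ≤ ∑ l ∈ Finset.range p,
          ((if Nat.dist (σ k) (σ l) < L then 1 else 0) + ε / 2) := by
          refine Finset.sum_le_sum fun l _ => ?_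
          split_ifs with h
          · have := hr1 (Nat.dist (σ k) (σ l))
            linarith
          · have := hL _ (not_lt.1 h)
            linarith
      _ = (((Finset.range p).filter fun l => Nat.dist (σ k) (σ l) < L).card : ℝ)
          + p * (ε / 2) := by
          rw [Finset.sum_add_distrib, Finset.sum_boole]; simp
      _ ≤ _ := by
          have : (((Finset.range p).filter fun l => Nat.dist (σ k) (σ l) < L).card : ℝ)
              ≤ 2 * L := by exact_mod_cast hcard
          linarith
  have hnn : 0 ≤ ∑ k ∈ Finset.range p, ∑ l ∈ Finset.range p, r (Nat.dist (σ k) (σ l)) :=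
    Finset.sum_nonneg fun k _ => Finset.sum_nonneg fun l _ => hr0 _
  rw [Real.dist_eq, sub_zero, abs_of_nonneg (by positivity), div_lt_iff₀ (by positivity)]
  have hp1 : (p₀ : ℝ) < p := by
    have : p₀ < p := by omega
    exact_mod_cast this
  have h4 : 4 * (L : ℝ) < ε * p := by
    have := hp₀.trans hp1
    rwa [div_lt_iff₀ hε, mul_comm (p : ℝ)] at this
  calc _ ≤ ∑ _k ∈ Finset.range p, (2 * (L : ℝ) + p * (ε / 2)) :=
        Finset.sum_le_sum fun k _ => hrow k
    _ = p * (2 * (L : ℝ) + p * (ε / 2)) := by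
        rw [Finset.sum_const, Finset.card_range, nsmul_eq_mul]
    _ < _ := by nlinarith

end Mixing

/-! ### Second moments of weighted sums -/

section SecondMoments

variable {Ω : Type*} [MeasurableSpace Ω] {P : Measure Ω}

lemma memLp_sum_mul {s : Finset ℕ} (a : ℕ → ℝ) {Y : ℕ → Ω → ℝ} (hY : ∀ k, MemLp (Y k) 2 P) :
    MemLp (fun ω => ∑ k ∈ s, a k * Y k ω) 2 P :=
  memLp_finsetSum _ fun k _ => (hY k).const_mul (a k)

lemma integral_sq_sum_mul {s : Finset ℕ} (a : ℕ → ℝ) {Y : ℕ → Ω → ℝ} (hY : ∀ k, MemLp (Y k) 2 P) :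
    ∫ ω, (∑ k ∈ s, a k * Y k ω) ^ 2 ∂P
      = ∑ k ∈ s, ∑ l ∈ s, a k * a l * ∫ ω, Y k ω * Y l ω ∂P := by
  have hint : ∀ k l, Integrable (fun ω => Y k ω * Y l ω) P := fun k l =>
    (hY k).integrable_mul (hY l)
  have h1 : ∀ ω, (∑ k ∈ s, a k * Y k ω) ^ 2
      = ∑ k ∈ s, ∑ l ∈ s, a k * a l * (Y k ω * Y l ω) := by
    intro ω
    rw [sq, Finset.sum_mul_sum]
    exact Finset.sum_congr rfl fun k _ => Finset.sum_congr rfl fun l _ => by ring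
  simp_rw [h1]
  rw [integral_finsetSum _ fun k _ => integrable_finsetSum _ fun l _ => (hint k l).const_mul _]
  refine Finset.sum_congr rfl fun k _ => ?_
  rw [integral_finsetSum _ fun l _ => (hint k l).const_mul _]
  exact Finset.sum_congr rfl fun l _ => integral_const_mul _ _

lemma integral_sq_sum_mul_of_orthonormal {s : Finset ℕ} (a : ℕ → ℝ) {Y : ℕ → Ω → ℝ}
    (hY : ∀ k, MemLp (Y k) 2 P) (hort : ∀ k l, ∫ ω, Y k ω * Y l ω ∂P = if k = l then 1 else 0) :
    ∫ ω, (∑ k ∈ s, a k * Y k ω) ^ 2 ∂P = ∑ k ∈ s, a k ^ 2 := by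
  rw [integral_sq_sum_mul a hY]
  refine Finset.sum_congr rfl fun k hk => ?_
  simp [hort, hk, sq]

/-- Chebyshev's inequality along a sequence. -/
lemma tendsto_measure_le_abs_of_integral_sq [IsProbabilityMeasure P] {f : ℕ → Ω → ℝ}
    {b : ℕ → ℝ} (hf : ∀ᶠ p in atTop, MemLp (f p) 2 P)
    (hb : ∀ᶠ p in atTop, ∫ ω, f p ω ^ 2 ∂P ≤ b p) (hb0 : Tendsto b atTop (𝓝 0)) {δ : ℝ}
    (hδ : 0 < δ) : Tendsto (fun p => P {ω | δ ≤ |f p ω|}) atTop (𝓝 0) := by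
  have h1 : Tendsto (fun p => P.real {ω | δ ≤ |f p ω|}) atTop (𝓝 0) := by
    have h2 : Tendsto (fun p => b p / δ ^ 2) atTop (𝓝 0) := by simpa using hb0.div_const (δ ^ 2)
    refine squeeze_zero' (Eventually.of_forall fun p => measureReal_nonneg) ?_ h2
    filter_upwards [hf, hb] with p hp hbp
    have h3 := mul_meas_ge_le_integral_of_nonneg (μ := P) (f := fun ω => f p ω ^ 2)
      (ae_of_all _ fun ω => sq_nonneg _) hp.integrable_sq (δ ^ 2)
    have h4 : {ω | δ ≤ |f p ω|} = {ω | δ ^ 2 ≤ f p ω ^ 2} := by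
      ext ω
      simp only [Set.mem_ofPred_eq]
      rw [sq_le_sq, abs_of_pos hδ]
    rw [h4, le_div_iff₀ (by positivity)]
    linarith
  have h5 := ENNReal.tendsto_ofReal h1
  simpa [ofReal_measureReal] using h5

end SecondMoments

/-! ### Laws of large numbers for the scores -/

/-- The standardized scores of `n` independent observations along an infinite sequence of
directions: uncorrelated with unit second moments for each observation, independent between
observations, with bounded fourth moments, and `ρ`-mixing after a permutation. -/
structure IsWhiteScores {Ω : Type*} [MeasurableSpace Ω] (P : Measure Ω) {n : ℕ}
    (Z : ℕ → Fin n → Ω → ℝ) : Prop where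
  measurable : ∀ k i, Measurable (Z k i)
  fourthMoment : ∃ C : ℝ, ∀ k i, Integrable (fun ω => Z k i ω ^ 4) P ∧ ∫ ω, Z k i ω ^ 4 ∂P ≤ C
  orthonormal : ∀ i k l, ∫ ω, Z k i ω * Z l i ω ∂P = if k = l then 1 else 0
  indep : ∀ i j, i ≠ j → ∀ k l,
    IndepFun (fun ω => (Z k i ω, Z l i ω)) (fun ω => (Z k j ω, Z l j ω)) P
  mixing : ∀ i, ∃ e : Equiv.Perm ℕ, IsRhoMixing P (fun k => Z (e k) i)

lemma tendsto_sum_sq_div_zero {tau : ℕ → ℕ → ℝ} {C : ℝ} (m : ℕ)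
    (htau : ∀ᶠ p in atTop, ∀ k < p, 0 < tau p k ∧ tau p k ≤ C) :
    Tendsto (fun p : ℕ => ∑ k ∈ Finset.Ico m p, (tau p k / p) ^ 2) atTop (𝓝 0) := by
  have h1 : Tendsto (fun p : ℕ => C ^ 2 / (p : ℝ)) atTop (𝓝 0) :=
    tendsto_const_div_atTop_nhds_zero_nat _
  refine squeeze_zero' (Eventually.of_forall fun p => Finset.sum_nonneg fun k _ => sq_nonneg _) ?_
    h1
  filter_upwards [htau, eventually_gt_atTop 0] with p hp hp0
  have hp0' : (0 : ℝ) < p := by exact_mod_cast hp0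
  calc _ ≤ ∑ k ∈ Finset.Ico m p, (C / p) ^ 2 := by
        refine Finset.sum_le_sum fun k hk => ?_
        obtain ⟨h2, h3⟩ := hp k (Finset.mem_Ico.1 hk).2
        gcongr
    _ = ((p - m : ℕ) : ℝ) * (C / p) ^ 2 := by simp
    _ ≤ p * (C / p) ^ 2 := by
        gcongr
        exact Nat.sub_le p m
    _ = _ := by field_simp

namespace IsWhiteScores

variable {Ω : Type*} [MeasurableSpace Ω] {P : Measure Ω} {n : ℕ}
  {Z : ℕ → Fin n → Ω → ℝ}

lemma memLp_sq (h : IsWhiteScores P Z) (k : ℕ) (i : Fin n) :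
    MemLp (fun ω => Z k i ω ^ 2) 2 P := by
  obtain ⟨C, hC⟩ := h.fourthMoment
  rw [memLp_two_iff_integrable_sq ((h.measurable k i).pow_const 2).aestronglyMeasurable]
  simpa [← pow_mul] using (hC k i).1

variable [IsProbabilityMeasure P]

lemma memLp (h : IsWhiteScores P Z) (k : ℕ) (i : Fin n) : MemLp (Z k i) 2 P := by
  rw [memLp_two_iff_integrable_sq (h.measurable k i).aestronglyMeasurable]
  exact (h.memLp_sq k i).integrable (by norm_num)

lemma tendsto_measure_le_abs_linear (h : IsWhiteScores P Z) (i : Fin n) (m : ℕ) {a : ℕ → ℕ → ℝ}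
    (ha : Tendsto (fun p => ∑ k ∈ Finset.Ico m p, a p k ^ 2) atTop (𝓝 0)) {δ : ℝ} (hδ : 0 < δ) :
    Tendsto (fun p => P {ω | δ ≤ |∑ k ∈ Finset.Ico m p, a p k * Z k i ω|}) atTop (𝓝 0) :=
  tendsto_measure_le_abs_of_integral_sq
    (Eventually.of_forall fun p => memLp_sum_mul (a p) fun k => h.memLp k i)
    (Eventually.of_forall fun p => (integral_sq_sum_mul_of_orthonormal (a p)
      (fun k => h.memLp k i) (h.orthonormal i)).le) ha hδ

/-- Cross products of the scores of two observations average out. -/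
lemma tendsto_measure_le_abs_cross (h : IsWhiteScores P Z) {i j : Fin n} (hij : i ≠ j) (m : ℕ)
    {tau : ℕ → ℕ → ℝ} {C : ℝ} (htau : ∀ᶠ p in atTop, ∀ k < p, 0 < tau p k ∧ tau p k ≤ C)
    {δ : ℝ} (hδ : 0 < δ) :
    Tendsto (fun p : ℕ => P {ω | δ ≤ |∑ k ∈ Finset.Ico m p, tau p k / p * (Z k i ω * Z k j ω)|})
      atTop (𝓝 0) := by
  have hmeas : ∀ k, AEStronglyMeasurable (fun ω => Z k i ω * Z k j ω) P := fun k =>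
    ((h.measurable k i).mul (h.measurable k j)).aestronglyMeasurable
  have hmem : ∀ k, MemLp (fun ω => Z k i ω * Z k j ω) 2 P := by
    intro k
    rw [memLp_two_iff_integrable_sq (hmeas k)]
    simp_rw [mul_pow]
    exact (h.memLp_sq k i).integrable_mul (h.memLp_sq k j)
  have hort : ∀ k l, ∫ ω, (Z k i ω * Z k j ω) * (Z l i ω * Z l j ω) ∂P
      = if k = l then 1 else 0 := by
    intro k l
    have h1 : ∀ ω, (Z k i ω * Z k j ω) * (Z l i ω * Z l j ω)
        = (Z k i ω * Z l i ω) * (Z k j ω * Z l j ω) := fun ω => by ring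
    have hm : Measurable fun x : ℝ × ℝ => x.1 * x.2 := measurable_fst.mul measurable_snd
    have h2 : IndepFun (fun ω => Z k i ω * Z l i ω) (fun ω => Z k j ω * Z l j ω) P :=
      (h.indep i j hij k l).comp hm hm
    simp_rw [h1]
    rw [h2.integral_fun_mul_eq_mul_integral
      ((h.measurable k i).mul (h.measurable l i)).aestronglyMeasurable
      ((h.measurable k j).mul (h.measurable l j)).aestronglyMeasurable, h.orthonormal,
      h.orthonormal]
    simp
  exact tendsto_measure_le_abs_of_integral_sq
    (Eventually.of_forall fun p => memLp_sum_mul (fun k => tau p k / p) hmem)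
    (Eventually.of_forall fun p =>
      (integral_sq_sum_mul_of_orthonormal (fun k => tau p k / p) hmem hort).le)
    (tendsto_sum_sq_div_zero m htau) hδ

/-- The mean square of the weighted deviations of the squared scores from one vanishes, by
`ρ`-mixing. -/
lemma tendsto_measure_le_abs_sq_sub_one (h : IsWhiteScores P Z) (i : Fin n) (m : ℕ)
    {tau : ℕ → ℕ → ℝ} {C : ℝ} (htau : ∀ᶠ p in atTop, ∀ k < p, 0 < tau p k ∧ tau p k ≤ C)
    {δ : ℝ} (hδ : 0 < δ) :
    Tendsto (fun p : ℕ => P {ω | δ ≤ |∑ k ∈ Finset.Ico m p, tau p k / p * (Z k i ω ^ 2 - 1)|})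
      atTop (𝓝 0) := by
  obtain ⟨D, hD⟩ := h.fourthMoment
  obtain ⟨e, he⟩ := h.mixing i
  set r := rhoMixingCoeff P (fun k => Z (e k) i) with hr
  have hmem : ∀ k, MemLp (fun ω => Z k i ω ^ 2 - 1) 2 P := fun k =>
    (h.memLp_sq k i).sub (memLp_const _)
  have hD0 : 0 ≤ D := (integral_nonneg fun ω => by positivity).trans (hD 0 i).2
  have hvar : ∀ k, √(Var[fun ω => Z k i ω ^ 2; P]) ≤ √D := by
    intro k
    refine Real.sqrt_le_sqrt ((variance_le_expectation_sq
      ((h.measurable k i).pow_const 2).aestronglyMeasurable).trans ?_)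
    have h1 : ∀ ω, ((fun ω => Z k i ω ^ 2) ^ 2) ω = Z k i ω ^ 4 := fun ω => by
      simp only [Pi.pow_apply]; ring
    rw [integral_congr_ae (ae_of_all _ h1)]
    exact (hD k i).2
  have hcov : ∀ k l, |∫ ω, (Z k i ω ^ 2 - 1) * (Z l i ω ^ 2 - 1) ∂P|
      ≤ r (Nat.dist (e.symm k) (e.symm l)) * D := by
    intro k l
    have hone : ∀ k, ∫ ω, Z k i ω ^ 2 ∂P = 1 := by
      intro k
      have := h.orthonormal i k k
      simpa [← sq] using this
    have h1 := abs_covariance_comp_le_rhoMixingCoeff_mul (P := P) (fun k => Z (e k) i)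
      (φ := fun x => x ^ 2) (measurable_id.pow_const 2) (e.symm k) (e.symm l)
      (by simpa using h.memLp_sq k i) (by simpa using h.memLp_sq l i)
    simp only [Equiv.apply_symm_apply] at h1
    rw [covariance, hone, hone] at h1
    refine h1.trans ?_
    gcongr
    · exact rhoMixingCoeff_nonneg _ _
    · calc _ ≤ √D * √D := mul_le_mul (hvar k) (hvar l) (by positivity) (by positivity)
        _ = D := Real.mul_self_sqrt hD0
  have hlim := (tendsto_average_dist (r := r) (fun l => rhoMixingCoeff_nonneg _ _)
    (fun l => rhoMixingCoeff_le_one _ _) he e.symm.injective).const_mul (C ^ 2 * D)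
  rw [mul_zero] at hlim
  refine tendsto_measure_le_abs_of_integral_sq
    (Eventually.of_forall fun p => memLp_sum_mul (fun k => tau p k / p) hmem) ?_ hlim hδ
  filter_upwards [htau, eventually_gt_atTop 0] with p hp hp0
  have hp0' : (0 : ℝ) < p := by exact_mod_cast hp0
  rw [integral_sq_sum_mul _ hmem]
  calc _ ≤ ∑ k ∈ Finset.Ico m p, ∑ l ∈ Finset.Ico m p,
        (C / p) * (C / p) * (r (Nat.dist (e.symm k) (e.symm l)) * D) := by
        refine Finset.sum_le_sum fun k hk => Finset.sum_le_sum fun l hl => ?_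
        obtain ⟨h2, h3⟩ := hp k (Finset.mem_Ico.1 hk).2
        obtain ⟨h4, h5⟩ := hp l (Finset.mem_Ico.1 hl).2
        refine (mul_le_mul_of_nonneg_left ((le_abs_self _).trans (hcov k l)) (by positivity)).trans
          ?_
        have := rhoMixingCoeff_nonneg (P := P) (fun k => Z (e k) i)
          (Nat.dist (e.symm k) (e.symm l))
        have h6 : 0 ≤ r (Nat.dist (e.symm k) (e.symm l)) * D := mul_nonneg this hD0
        have h7 : 0 ≤ C := h2.le.trans h3
        gcongr
    _ ≤ ∑ k ∈ Finset.range p, ∑ l ∈ Finset.range p,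
        (C / p) * (C / p) * (r (Nat.dist (e.symm k) (e.symm l)) * D) := by
        have hsub : Finset.Ico m p ⊆ Finset.range p := by
          intro k; simp only [Finset.mem_range, Finset.mem_Ico]; omega
        have hnn : ∀ k l, 0 ≤ (C / p) * (C / p) * (r (Nat.dist (e.symm k) (e.symm l)) * D) := by
          intro k l
          have := rhoMixingCoeff_nonneg (P := P) (fun k => Z (e k) i)
            (Nat.dist (e.symm k) (e.symm l))
          exact mul_nonneg (mul_self_nonneg _) (mul_nonneg this hD0)
        calc _ ≤ ∑ k ∈ Finset.Ico m p, ∑ l ∈ Finset.range p,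
              (C / p) * (C / p) * (r (Nat.dist (e.symm k) (e.symm l)) * D) :=
              Finset.sum_le_sum fun k _ =>
                Finset.sum_le_sum_of_subset_of_nonneg hsub fun l _ _ => hnn k l
          _ ≤ _ := Finset.sum_le_sum_of_subset_of_nonneg hsub fun k _ _ =>
                Finset.sum_nonneg fun l _ => hnn k l
    _ = _ := by
        rw [Finset.sum_div, Finset.mul_sum]
        refine Finset.sum_congr rfl fun k _ => ?_
        rw [Finset.sum_div, Finset.mul_sum]
        refine Finset.sum_congr rfl fun l _ => ?_
        field_simp

/-- The law of large numbers for the squared scores. -/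
lemma tendsto_measure_le_abs_sq (h : IsWhiteScores P Z) (i : Fin n) (m : ℕ)
    {tau : ℕ → ℕ → ℝ} {C tau2 : ℝ} (htau : ∀ᶠ p in atTop, ∀ k < p, 0 < tau p k ∧ tau p k ≤ C)
    (havg : Tendsto (fun p : ℕ => (∑ k ∈ Finset.range p, tau p k) / (p : ℝ)) atTop (𝓝 tau2))
    {δ : ℝ} (hδ : 0 < δ) :
    Tendsto (fun p : ℕ => P {ω | δ ≤ |∑ k ∈ Finset.Ico m p, tau p k / p * (Z k i ω * Z k i ω)
      - tau2|}) atTop (𝓝 0) := by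
  have hhead : Tendsto (fun p : ℕ => ∑ k ∈ Finset.range m, tau p k / p) atTop (𝓝 0) := by
    rw [← Finset.sum_const_zero (s := Finset.range m)]
    refine tendsto_finsetSum _ fun k _ => ?_
    refine squeeze_zero' ?_ ?_ (tendsto_const_div_atTop_nhds_zero_nat C)
    · filter_upwards [htau, eventually_gt_atTop k] with p hp hkp
      have := (hp k hkp).1
      positivity
    · filter_upwards [htau, eventually_gt_atTop k] with p hp hkp
      have := (hp k hkp).2
      gcongr
  have htail : Tendsto (fun p : ℕ => ∑ k ∈ Finset.Ico m p, tau p k / p) atTop (𝓝 tau2) := by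
    have h1 := havg.sub hhead
    rw [sub_zero] at h1
    refine h1.congr' ?_
    filter_upwards [eventually_ge_atTop m] with p hp
    rw [Finset.sum_div, ← Finset.sum_range_add_sum_Ico _ hp]
    ring
  refine tendsto_of_tendsto_of_tendsto_of_le_of_le' tendsto_const_nhds
    (h.tendsto_measure_le_abs_sq_sub_one i m htau (half_pos hδ))
    (Eventually.of_forall fun _ => zero_le) ?_
  filter_upwards [(Metric.tendsto_nhds.1 htail) _ (half_pos hδ)] with p hp
  refine measure_mono fun ω hω => ?_
  simp only [Set.mem_ofPred_eq] at hω ⊢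
  rw [Real.dist_eq] at hp
  have h1 : ∑ k ∈ Finset.Ico m p, tau p k / p * (Z k i ω * Z k i ω) - tau2
      = ∑ k ∈ Finset.Ico m p, tau p k / p * (Z k i ω ^ 2 - 1)
        + (∑ k ∈ Finset.Ico m p, tau p k / p - tau2) := by
    have : ∀ k, tau p k / p * (Z k i ω * Z k i ω)
        = tau p k / p * (Z k i ω ^ 2 - 1) + tau p k / p := fun k => by ring
    simp_rw [this]
    rw [Finset.sum_add_distrib]; ring
  rw [h1] at hω
  have h2 := abs_add_le (∑ k ∈ Finset.Ico m p, tau p k / p * (Z k i ω ^ 2 - 1))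
    (∑ k ∈ Finset.Ico m p, tau p k / p - tau2)
  linarith

end IsWhiteScores

/-! ### The span of the leading directions -/

section LeadingSpan

variable {m p : ℕ} {u : ℕ → EuclideanSpace ℝ (Fin p)}

/-- The span of the first `m` directions. -/
def leadingSpan (m : ℕ) (u : ℕ → EuclideanSpace ℝ (Fin p)) :
    Submodule ℝ (EuclideanSpace ℝ (Fin p)) :=
  Submodule.span ℝ (u '' Set.Iio m)

lemma mem_leadingSpan {k : ℕ} (hk : k < m) : u k ∈ leadingSpan m u :=
  Submodule.subset_span ⟨k, hk, rfl⟩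

lemma finrank_leadingSpan (hu : Orthonormal ℝ (fun k : Fin p => u k)) (hm : m ≤ p) :
    Module.finrank ℝ (leadingSpan m u) = m := by
  have h1 : Orthonormal ℝ (fun k : Fin m => u k) :=
    hu.comp (Fin.castLE hm) (Fin.castLE_injective hm)
  have h2 := finrank_span_eq_card h1.linearIndependent
  have h3 : Set.range (fun k : Fin m => u k) = u '' Set.Iio m := by
    ext y
    constructor
    · rintro ⟨k, rfl⟩
      exact ⟨k, k.2, rfl⟩
    · rintro ⟨k, hk, rfl⟩
      exact ⟨⟨k, hk⟩, rfl⟩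
  rw [h3, Fintype.card_fin] at h2
  exact h2

lemma starProjection_leadingSpan (hu : Orthonormal ℝ (fun k : Fin p => u k)) (hm : m ≤ p)
    (z : EuclideanSpace ℝ (Fin p)) :
    (leadingSpan m u).starProjection z = ∑ k ∈ Finset.range m, inner ℝ (u k) z • u k := by
  refine Submodule.eq_starProjection_of_mem_of_inner_eq_zero
    (Submodule.sum_mem _ fun k hk => Submodule.smul_mem _ _
      (mem_leadingSpan (Finset.mem_range.1 hk))) fun y hy => ?_
  rw [leadingSpan] at hy
  induction hy using Submodule.span_induction with
  | mem y hy =>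
    obtain ⟨k, hk, rfl⟩ := hy
    have hk : k < m := hk
    rw [real_inner_comm, inner_sub_right, inner_sum_smul_of_orthonormal_fin hu
      (Finset.range_subset_range.2 hm) _ (hk.trans_le hm), if_pos (Finset.mem_range.2 hk), sub_self]
  | zero => simp
  | add y y' _ _ h h' => rw [inner_add_right, h, h', add_zero]
  | smul a y _ h => rw [inner_smul_right, h, mul_zero]

lemma sum_inner_smul_eq_self (hu : Orthonormal ℝ (fun k : Fin p => u k))
    (z : EuclideanSpace ℝ (Fin p)) : ∑ k ∈ Finset.range p, inner ℝ (u k) z • u k = z := by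
  rw [← starProjection_leadingSpan hu le_rfl, Submodule.starProjection_eq_self_iff]
  rw [Submodule.eq_top_of_finrank_eq
    ((finrank_leadingSpan hu le_rfl).trans finrank_euclideanSpace_fin.symm)]
  trivial

lemma sub_starProjection_leadingSpan (hu : Orthonormal ℝ (fun k : Fin p => u k)) (hm : m ≤ p)
    (z : EuclideanSpace ℝ (Fin p)) :
    z - (leadingSpan m u).starProjection z = ∑ k ∈ Finset.Ico m p, inner ℝ (u k) z • u k := by
  nth_rw 1 [← sum_inner_smul_eq_self hu z]
  rw [starProjection_leadingSpan hu hm, ← Finset.sum_range_add_sum_Ico _ hm, add_sub_cancel_left]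

lemma inner_sub_starProjection_leadingSpan (hu : Orthonormal ℝ (fun k : Fin p => u k))
    (hm : m ≤ p) (y z : EuclideanSpace ℝ (Fin p)) :
    inner ℝ y (z - (leadingSpan m u).starProjection z)
      = ∑ k ∈ Finset.Ico m p, inner ℝ (u k) y * inner ℝ (u k) z := by
  rw [sub_starProjection_leadingSpan hu hm, inner_sum]
  exact Finset.sum_congr rfl fun k _ => by
    rw [inner_smul_right, real_inner_comm y, mul_comm]

lemma inner_eq_sum_of_mem_leadingSpan (hu : Orthonormal ℝ (fun k : Fin p => u k)) (hm : m ≤ p)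
    (y : EuclideanSpace ℝ (Fin p)) {z : EuclideanSpace ℝ (Fin p)} (hz : z ∈ leadingSpan m u) :
    inner ℝ y z = ∑ k ∈ Finset.range m, inner ℝ (u k) y * inner ℝ (u k) z := by
  conv_lhs => rw [← (Submodule.starProjection_eq_self_iff).2 hz]
  rw [starProjection_leadingSpan hu hm, inner_sum]
  exact Finset.sum_congr rfl fun k _ => by
    rw [inner_smul_right, real_inner_comm y, mul_comm]

end LeadingSpan

/-! ### Signal and noise in terms of the scores -/

/-- The differences between the first `m` scores of the observations `1, …, m` and those of the
observation `0`. -/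
def scoreDiff {m n : ℕ} (hmn : m + 2 ≤ n) (z : ℕ → Fin n → ℝ) : Fin m → Fin m → ℝ :=
  fun i k => z k ⟨i + 1, by omega⟩ - z k ⟨0, by omega⟩

section Scores

variable {m n p : ℕ} {u : ℕ → EuclideanSpace ℝ (Fin p)} {x : Fin n → EuclideanSpace ℝ (Fin p)}
  {b : EuclideanSpace ℝ (Fin p)} {lam : ℕ → ℝ} {z : ℕ → Fin n → ℝ}

/-- The signal is bounded below on the leading span if the differences of the leading scores form
a matrix with a bounded inverse. -/
lemma mul_norm_sq_le_norm_sq_contrastAdjoint (hu : Orthonormal ℝ (fun k : Fin p => u k))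
    (hm : 1 ≤ m) (hmn : m + 2 ≤ n) (hpn : n < p)
    (hz : ∀ k < p, ∀ i, inner ℝ (u k) (x i - b) = √(lam k) * z k i) {s N : ℝ} (hs : 0 ≤ s)
    (hN : 0 < N) (hlam : ∀ k < m, s * p ≤ lam k) (hq : IsUnit (Matrix.of (scoreDiff hmn z)))
    (hqN : sumSqInv (scoreDiff hmn z) ≤ N) {y : EuclideanSpace ℝ (Fin p)}
    (hy : y ∈ leadingSpan m u) :
    s / (4 * m * N) * ‖y‖ ^ 2 ≤ ‖contrastAdjoint (√(p : ℝ))⁻¹ (fun i => x i - b) y‖ ^ 2 := by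
  have hp : (0 : ℝ) < p := by
    have : 0 < p := by omega
    exact_mod_cast this
  have hmp : m ≤ p := by omega
  have hm' : (0 : ℝ) < m := by exact_mod_cast hm
  set a := ‖contrastAdjoint (√(p : ℝ))⁻¹ (fun i => x i - b) y‖ ^ 2 with ha
  set c : Fin m → ℝ := fun k => √(lam k) * (√(p : ℝ))⁻¹ * inner ℝ (u k) y with hc
  have h1 : s * ‖y‖ ^ 2 ≤ ∑ k, c k ^ 2 := by
    rw [← real_inner_self_eq_norm_sq, inner_eq_sum_of_mem_leadingSpan hu hmp y hy, Finset.mul_sum,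
      ← Fin.sum_univ_eq_sum_range (fun k => s * (inner ℝ (u k) y * inner ℝ (u k) y))]
    refine Finset.sum_le_sum fun k _ => ?_
    have h2 := hlam k k.2
    have h3 : c k ^ 2 = lam k / p * inner ℝ (u k) y ^ 2 := by
      rw [hc]
      simp only [mul_pow, inv_pow]
      rw [Real.sq_sqrt hp.le, Real.sq_sqrt (le_trans (by positivity) h2), div_eq_mul_inv]
    rw [h3, ← sq]
    gcongr
    rwa [le_div_iff₀ hp]
  have h2 : ∀ i : Fin m, (∑ k, scoreDiff hmn z i k * c k) ^ 2 ≤ 4 * a := by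
    intro i
    have h3 := sq_dataAdjoint_sub_le (√(p : ℝ))⁻¹ (fun i => x i - b) y ⟨i + 1, by omega⟩
      ⟨0, by omega⟩
    convert h3 using 2
    rw [dataAdjoint_apply, dataAdjoint_apply, inner_eq_sum_of_mem_leadingSpan hu hmp _ hy,
      inner_eq_sum_of_mem_leadingSpan hu hmp _ hy, ← mul_sub, ← Finset.sum_sub_distrib,
      ← Fin.sum_univ_eq_sum_range (fun k => inner ℝ (u k) (x ⟨i + 1, by omega⟩ - b) *
        inner ℝ (u k) y - inner ℝ (u k) (x ⟨0, by omega⟩ - b) * inner ℝ (u k) y), Finset.mul_sum]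
    refine Finset.sum_congr rfl fun k _ => ?_
    rw [hz k (by omega), hz k (by omega), scoreDiff, hc]
    ring
  have h3 := sum_sq_le_sumSqInv_mul hq c
  have h4 : ∑ i : Fin m, (∑ k, scoreDiff hmn z i k * c k) ^ 2 ≤ m * (4 * a) :=
    calc _ ≤ ∑ _i : Fin m, 4 * a := Finset.sum_le_sum fun i _ => h2 i
      _ = _ := by rw [Finset.sum_const, Finset.card_univ, Fintype.card_fin, nsmul_eq_mul]
  have h5 : sumSqInv (scoreDiff hmn z) * ∑ i : Fin m, (∑ k, scoreDiff hmn z i k * c k) ^ 2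
      ≤ N * (m * (4 * a)) := mul_le_mul hqN h4 (by positivity) hN.le
  rw [div_mul_eq_mul_div, div_le_iff₀ (by positivity)]
  linarith

/-- The signal is bounded above on the leading span if the leading scores are bounded. -/
lemma norm_sq_contrastAdjoint_le (hu : Orthonormal ℝ (fun k : Fin p => u k)) (hp : 0 < p)
    (hmp : m ≤ p) (hz : ∀ k < p, ∀ i, inner ℝ (u k) (x i - b) = √(lam k) * z k i) {B N : ℝ}
    (hB : 0 ≤ B) (hlam0 : ∀ k < m, 0 ≤ lam k) (hlam : ∀ k < m, lam k ≤ B * p)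
    (hzN : ∑ i, ∑ k ∈ Finset.range m, z k i ^ 2 ≤ N) {y : EuclideanSpace ℝ (Fin p)}
    (hy : y ∈ leadingSpan m u) :
    ‖contrastAdjoint (√(p : ℝ))⁻¹ (fun i => x i - b) y‖ ^ 2 ≤ B * N * ‖y‖ ^ 2 := by
  have hp' : (0 : ℝ) < p := by exact_mod_cast hp
  have h1 : ∀ i, dataAdjoint (√(p : ℝ))⁻¹ (fun i => x i - b) y i ^ 2
      ≤ B * (∑ k ∈ Finset.range m, z k i ^ 2) * ‖y‖ ^ 2 := by
    intro i
    rw [dataAdjoint_apply, inner_eq_sum_of_mem_leadingSpan hu hmp _ hy,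
      ← real_inner_self_eq_norm_sq, inner_eq_sum_of_mem_leadingSpan hu hmp y hy, mul_pow, inv_pow,
      Real.sq_sqrt hp'.le]
    have h2 := Finset.sum_mul_sq_le_sq_mul_sq (Finset.range m)
      (fun k => inner ℝ (u k) (x i - b)) (fun k => inner ℝ (u k) y)
    have h3 : ∑ k ∈ Finset.range m, inner ℝ (u k) (x i - b) ^ 2
        ≤ p * (B * ∑ k ∈ Finset.range m, z k i ^ 2) := by
      rw [Finset.mul_sum, Finset.mul_sum]
      refine Finset.sum_le_sum fun k hk => ?_
      have hk := Finset.mem_range.1 hk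
      rw [hz k (by omega), mul_pow, Real.sq_sqrt (hlam0 k hk)]
      have := hlam k hk
      calc _ ≤ B * p * z k i ^ 2 := by gcongr
        _ = _ := by ring
    simp_rw [← sq]
    calc _ ≤ (p : ℝ)⁻¹ * ((p * (B * ∑ k ∈ Finset.range m, z k i ^ 2))
          * ∑ k ∈ Finset.range m, inner ℝ (u k) y ^ 2) := by
          gcongr
          exact h2.trans (by gcongr)
      _ = _ := by field_simp
  calc _ ≤ ‖dataAdjoint (√(p : ℝ))⁻¹ (fun i => x i - b) y‖ ^ 2 := by
        gcongr
        exact norm_contrastAdjoint_le _ _ _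
    _ ≤ ∑ i, B * (∑ k ∈ Finset.range m, z k i ^ 2) * ‖y‖ ^ 2 := by
        rw [EuclideanSpace.real_norm_sq_eq]
        exact Finset.sum_le_sum fun i _ => h1 i
    _ = B * (∑ i, ∑ k ∈ Finset.range m, z k i ^ 2) * ‖y‖ ^ 2 := by
        rw [Finset.mul_sum, Finset.sum_mul]
    _ ≤ _ := by gcongr

/-- The centred data form a spiked operator if the leading scores are in general position and
bounded and the trailing scores of the observations are almost orthogonal. -/
lemma isSpikedOperator_of_scores (hu : Orthonormal ℝ (fun k : Fin p => u k)) (hm : 1 ≤ m)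
    (hmn : m + 2 ≤ n) (hpn : n < p) {ev : ℕ → ℝ} {w : ℕ → EuclideanSpace ℝ (Fin p)}
    (h : IsOrderedEigendecomposition (n - 1) (sampleCov x) ev w) (hlam0 : ∀ k < p, 0 ≤ lam k)
    (hz : ∀ k < p, ∀ i, inner ℝ (u k) (x i - b) = √(lam k) * z k i) {s B N t δ : ℝ}
    (hs : 0 ≤ s) (hB : 0 ≤ B) (hN : 0 < N) (hδ : 0 ≤ δ)
    (hsl : ∀ k < m, s * p ≤ lam k) (hBl : ∀ k < m, lam k ≤ B * p)
    (hq : IsUnit (Matrix.of (scoreDiff hmn z))) (hqN : sumSqInv (scoreDiff hmn z) ≤ N)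
    (hzN : ∑ i, ∑ k ∈ Finset.range m, z k i ^ 2 ≤ N)
    (hT : ∀ i j, |∑ k ∈ Finset.Ico m p, lam k / p * (z k i * z k j) - if i = j then t else 0|
      ≤ δ) :
    IsSpikedOperator (contrastMap (√(p : ℝ))⁻¹ fun i => x i - b)
      (contrastAdjoint (√(p : ℝ))⁻¹ fun i => x i - b) (leadingSpan m u) (n - 1)
      (fun k => n / p * ev k) w t (n * δ) (s / (4 * m * N)) (B * N) := by
  have hmp : m ≤ p := by omega
  refine isSpikedOperator_contrastMap (by omega) (by omega) b h _ hδ (by positivity) ?_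
    (fun y hy => mul_norm_sq_le_norm_sq_contrastAdjoint hu hm hmn hpn hz hs hN hsl hq hqN hy)
    (fun y hy => norm_sq_contrastAdjoint_le hu (by omega) hmp hz hB
      (fun k hk => hlam0 k (by omega)) hBl hzN hy)
  intro i j
  convert hT i j using 3
  have horth : inner ℝ ((leadingSpan m u).starProjection (x i - b))
      ((x j - b) - (leadingSpan m u).starProjection (x j - b)) = 0 := by
    rw [real_inner_comm]
    exact Submodule.starProjection_inner_eq_zero _ _ (Submodule.starProjection_apply_mem _ _)
  rw [inner_sub_left, horth, sub_zero, inner_sub_starProjection_leadingSpan hu hmp, inv_pow,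
    Real.sq_sqrt (by positivity), Finset.mul_sum]
  refine Finset.sum_congr rfl fun k hk => ?_
  have hk := (Finset.mem_Ico.1 hk).2
  rw [hz k hk, hz k hk]
  have := Real.mul_self_sqrt (hlam0 k hk)
  calc _ = (p : ℝ)⁻¹ * (√(lam k) * √(lam k)) * (z k i * z k j) := by ring
    _ = _ := by rw [this]; ring

lemma norm_contrastAdjoint_sub_starProjection_le (hu : Orthonormal ℝ (fun k : Fin p => u k))
    (hmp : m ≤ p) (hz : ∀ k < p, ∀ i, inner ℝ (u k) (x i - b) = √(lam k) * z k i) {δ : ℝ}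
    (hδ : 0 ≤ δ) (v : EuclideanSpace ℝ (Fin p))
    (hv : ∀ i, |∑ k ∈ Finset.Ico m p, (√(lam k) / √(p : ℝ) * inner ℝ (u k) v) * z k i| ≤ δ) :
    ‖contrastAdjoint (√(p : ℝ))⁻¹ (fun i => x i - b)
      (v - (leadingSpan m u).starProjection v)‖ ≤ n * δ := by
  refine norm_contrastAdjoint_le_of_abs_le _ _ _ hδ fun i => ?_
  convert hv i using 2
  rw [inner_sub_starProjection_leadingSpan hu hmp, Finset.mul_sum]
  refine Finset.sum_congr rfl fun k hk => ?_
  rw [hz k (Finset.mem_Ico.1 hk).2]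
  ring

end Scores

/-! ### Moments, independence and general position of the population scores -/

section PopulationScores

variable {Ω : Type*} [MeasurableSpace Ω] {P : Measure Ω} {n p : ℕ}
  {X : Fin n → Ω → EuclideanSpace ℝ (Fin p)} {mean : EuclideanSpace ℝ (Fin p)}
  {Sig : Matrix (Fin p) (Fin p) ℝ} {lam : ℕ → ℝ} {u : ℕ → EuclideanSpace ℝ (Fin p)}

lemma IsOrderedEigendecomposition.mulVec_eigenvector (h : IsOrderedEigendecomposition p Sig lam u)
    {l : ℕ} (hl : l < p) : WithLp.toLp 2 (Sig.mulVec (u l).ofLp) = lam l • u l := by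
  rw [h.eq_sum, sum_outerSelf_mulVec, Finset.sum_eq_single l]
  · rw [inner_of_orthonormal_fin h.orthonormal hl hl]; simp
  · intro k hk hkl
    rw [inner_of_orthonormal_fin h.orthonormal (Finset.mem_range.1 hk) hl, if_neg hkl]; simp
  · simp [hl]

lemma IsSample.integral_inner_mul_inner [IsProbabilityMeasure P] (h : IsSample P X mean Sig)
    (i : Fin n) (y z : EuclideanSpace ℝ (Fin p)) :
    ∫ ω, inner ℝ y (X i ω - mean) * inner ℝ z (X i ω - mean) ∂P
      = inner ℝ y (WithLp.toLp 2 (Sig.mulVec z.ofLp)) := by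
  have hmem : ∀ a, MemLp (fun ω => X i ω a) 2 P := fun a =>
    (EuclideanSpace.proj (𝕜 := ℝ) a).comp_memLp' (h.memLp i)
  have hmean : ∀ a, ∫ ω, X i ω a ∂P = mean a := by
    intro a
    have := (EuclideanSpace.proj (𝕜 := ℝ) a).integral_comp_comm
      ((h.memLp i).integrable (by norm_num))
    rw [h.mean_eq i] at this
    exact this
  have hmem' : ∀ a, MemLp (fun ω => X i ω a - mean a) 2 P := fun a =>
    (hmem a).sub (memLp_const _)
  have hcov : ∀ a b, ∫ ω, (X i ω a - mean a) * (X i ω b - mean b) ∂P = Sig a b := by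
    intro a b
    rw [← h.cov_eq i, covMatrix, covariance, hmean, hmean]
  have hint : ∀ a b, Integrable (fun ω => (X i ω a - mean a) * (X i ω b - mean b)) P :=
    fun a b => (hmem' a).integrable_mul (hmem' b)
  have h1 : ∀ ω, inner ℝ y (X i ω - mean) * inner ℝ z (X i ω - mean)
      = ∑ a, ∑ b, y a * z b * ((X i ω a - mean a) * (X i ω b - mean b)) := by
    intro ω
    simp only [PiLp.inner_apply, PiLp.sub_apply, RCLike.inner_apply, conj_trivial]
    rw [Finset.sum_mul_sum]
    exact Finset.sum_congr rfl fun a _ => Finset.sum_congr rfl fun b _ => by ring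
  simp_rw [h1]
  rw [integral_finsetSum _ fun a _ => integrable_finsetSum _ fun b _ => (hint a b).const_mul _,
    PiLp.inner_apply]
  refine Finset.sum_congr rfl fun a _ => ?_
  rw [integral_finsetSum _ fun b _ => (hint a b).const_mul _]
  simp only [integral_const_mul, hcov, RCLike.inner_apply, conj_trivial, Matrix.mulVec,
    dotProduct, Finset.sum_mul]
  exact Finset.sum_congr rfl fun b _ => by ring

lemma IsSample.integral_pcScore_mul_pcScore [IsProbabilityMeasure P] (h : IsSample P X mean Sig)
    (hSig : IsOrderedEigendecomposition p Sig lam u) (hlam : ∀ k < p, 0 < lam k) (i : Fin n)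
    {k l : ℕ} (hk : k < p) (hl : l < p) :
    ∫ ω, pcScore mean (lam k) (u k) (X i ω) * pcScore mean (lam l) (u l) (X i ω) ∂P
      = if k = l then 1 else 0 := by
  have h1 : ∀ ω, pcScore mean (lam k) (u k) (X i ω) * pcScore mean (lam l) (u l) (X i ω)
      = (√(lam k) * √(lam l))⁻¹ *
        (inner ℝ (u k) (X i ω - mean) * inner ℝ (u l) (X i ω - mean)) := by
    intro ω
    rw [pcScore, pcScore, div_mul_div_comm, div_eq_inv_mul]
  simp_rw [h1]
  rw [integral_const_mul, h.integral_inner_mul_inner, hSig.mulVec_eigenvector hl,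
    inner_smul_right, inner_of_orthonormal_fin hSig.orthonormal hk hl]
  split_ifs with hkl
  · subst hkl
    rw [Real.mul_self_sqrt (hlam k hk).le, mul_one, inv_mul_cancel₀ (hlam k hk).ne']
  · simp

lemma measurable_pcScore (mean : EuclideanSpace ℝ (Fin p)) (l : ℝ)
    (w : EuclideanSpace ℝ (Fin p)) : Measurable (pcScore mean l w) := by
  have : Continuous (pcScore mean l w) := by
    unfold pcScore
    fun_prop
  exact this.measurable

lemma inner_eq_sqrt_mul_pcScore {l : ℝ} (hl : 0 < l) (w x : EuclideanSpace ℝ (Fin p)) :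
    inner ℝ w (x - mean) = √l * pcScore mean l w x := by
  have : √l ≠ 0 := (Real.sqrt_pos.2 hl).ne'
  rw [pcScore]
  field_simp

/-- Almost surely, the differences of the leading scores form an invertible matrix. -/
lemma IsSample.ae_isUnit_scoreDiff [IsProbabilityMeasure P] (h : IsSample P X mean Sig)
    (hu : Orthonormal ℝ (fun k : Fin p => u k)) (hlam : ∀ k < p, 0 < lam k) {m : ℕ}
    (hmn : m + 2 ≤ n) (hpn : n < p) :
    ∀ᵐ ω ∂P, IsUnit (Matrix.of
      (scoreDiff hmn fun k i => pcScore mean (lam k) (u k) (X i ω))) := by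
  set L : EuclideanSpace ℝ (Fin p) →ₗ[ℝ] (Fin m → ℝ) :=
    LinearMap.pi fun k => (√(lam k))⁻¹ • innerₛₗ ℝ (u k) with hL
  have hLapp : ∀ y k, L y k = (√(lam k))⁻¹ * inner ℝ (u k) y := fun y k => by simp [hL]
  have hsurj : Function.Surjective L := by
    intro c
    obtain ⟨c', hc'⟩ : ∃ c' : ℕ → ℝ, ∀ k : Fin m, c' k = √(lam k) * c k :=
      ⟨fun k => if hk : k < m then √(lam k) * c ⟨k, hk⟩ else 0, fun k => dif_pos k.2⟩
    refine ⟨∑ k ∈ Finset.range m, c' k • u k, funext fun k => ?_⟩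
    rw [hLapp, inner_sum_smul_of_orthonormal_fin hu (Finset.range_subset_range.2 (by omega)) _
      (by omega), if_pos (Finset.mem_range.2 k.2), hc', ← mul_assoc, inv_mul_cancel₀, one_mul]
    exact (Real.sqrt_pos.2 (hlam k (by omega))).ne'
  have hinj : Function.Injective (Fin.castLE (by omega : m + 1 ≤ n)) := Fin.castLE_injective _
  filter_upwards [ae_linearIndependent_sub volume (X := fun i => X (Fin.castLE (by omega) i))
    (fun i => h.measurable _) (h.indep.precomp hinj) (fun i => h.absolutelyContinuous _) hsurj]
    with ω hω
  rw [← Matrix.linearIndependent_rows_iff_isUnit]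
  convert! hω using 1
  ext i k
  rw [Pi.sub_apply, hLapp, hLapp, Matrix.row, Matrix.of_apply, scoreDiff, pcScore, pcScore,
    inner_sub_right, inner_sub_right]
  have h1 : Fin.castLE (by omega : m + 1 ≤ n) i.succ = ⟨i + 1, by omega⟩ := rfl
  have h2 : Fin.castLE (by omega : m + 1 ≤ n) 0 = ⟨0, by omega⟩ := rfl
  rw [h1, h2]
  ring

end PopulationScores

lemma IsSpikedCovariance.lam_pos {n m : ℕ} {lam : ℕ → ℕ → ℝ} {sigSq : ℕ → ℝ}
    {tauSq : ℕ → ℕ → ℝ} {tau2 : ℝ} (h : IsSpikedCovariance n m lam sigSq tauSq tau2) {p : ℕ}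
    (hp : n < p) {k : ℕ} (hk : k < p) : 0 < lam p k := by
  have h1 := h.tauSq_pos p hp k hk
  rcases lt_or_ge k m with hkm | hkm
  · rw [h.spiked p hp k hkm]
    have := h.sigSq_pos k hkm
    positivity
  · rw [h.nonspiked p hp k hkm hk]
    exact h1

/-- The infinite sequences behind the standardized scores are white. -/
lemma exists_isWhiteScores {Ω : Type*} [MeasurableSpace Ω] {P : Measure Ω} [IsProbabilityMeasure P]
    {n : ℕ} {X : ∀ p : ℕ, Fin n → Ω → EuclideanSpace ℝ (Fin p)}
    {mean : ∀ p : ℕ, EuclideanSpace ℝ (Fin p)} {Sig : ∀ p : ℕ, Matrix (Fin p) (Fin p) ℝ}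
    {lam : ℕ → ℕ → ℝ} {u : ∀ p : ℕ, ℕ → EuclideanSpace ℝ (Fin p)}
    (hX : ∀ p, n < p → IsSample P (X p) (mean p) (Sig p))
    (hSig : ∀ p, n < p → IsOrderedEigendecomposition p (Sig p) (lam p) (u p))
    (hlam : ∀ p, n < p → ∀ k < p, 0 < lam p k)
    (hmix : IsMixingScores P
      (fun p k (i : Fin n) ω => pcScore (mean p) (lam p k) (u p k) (X p i ω))) :
    ∃ Z : ℕ → Fin n → Ω → ℝ, IsWhiteScores P Z ∧ ∀ p, n < p → ∀ k < p, ∀ i,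
      (fun ω => pcScore (mean p) (lam p k) (u p k) (X p i ω)) =ᵐ[P] Z k i := by
  obtain ⟨Z, hZm, hZ, hZ4, hZmix⟩ := hmix
  refine ⟨Z, ⟨hZm, hZ4, fun i k l => ?_, fun i j hij k l => ?_, hZmix⟩, hZ⟩
  · obtain ⟨p, hpn, hkp, hlp⟩ : ∃ p, n < p ∧ k < p ∧ l < p :=
      ⟨n + k + l + 1, by omega, by omega, by omega⟩
    rw [← (hX p hpn).integral_pcScore_mul_pcScore (hSig p hpn) (hlam p hpn) i hkp hlp]
    refine integral_congr_ae ?_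
    filter_upwards [hZ p hpn k hkp i, hZ p hpn l hlp i] with ω h1 h2
    rw [← h1, ← h2]
  · obtain ⟨p, hpn, hkp, hlp⟩ : ∃ p, n < p ∧ k < p ∧ l < p :=
      ⟨n + k + l + 1, by omega, by omega, by omega⟩
    have hφ : Measurable fun x : EuclideanSpace ℝ (Fin p) =>
        (pcScore (mean p) (lam p k) (u p k) x, pcScore (mean p) (lam p l) (u p l) x) :=
      (measurable_pcScore _ _ _).prodMk (measurable_pcScore _ _ _)
    have h1 := ((hX p hpn).indep.indepFun hij).comp hφ hφ
    refine h1.congr ?_ ?_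
    · filter_upwards [hZ p hpn k hkp i, hZ p hpn l hlp i] with ω h2 h3
      rw [← h2, ← h3]
      rfl
    · filter_upwards [hZ p hpn k hkp j, hZ p hpn l hlp j] with ω h2 h3
      rw [← h2, ← h3]
      rfl

/-! ### Convergence in probability -/

/-- The events on which the ridged vector fails to exist, vanishes, or has an angle with `u i` that
is not within `η` of a right angle have vanishing probability. -/
lemma tendsto_measure_not_almost_orthogonal {Ω : Type*} [MeasurableSpace Ω] (P : Measure Ω)
    [IsProbabilityMeasure P] {n m r : ℕ} (hm : 1 ≤ m) (hmn : m + 2 ≤ n)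
    {X : ∀ p : ℕ, Fin n → Ω → EuclideanSpace ℝ (Fin p)}
    {mean : ∀ p : ℕ, EuclideanSpace ℝ (Fin p)} {Sig : ∀ p : ℕ, Matrix (Fin p) (Fin p) ℝ}
    {lam : ℕ → ℕ → ℝ} {u : ∀ p : ℕ, ℕ → EuclideanSpace ℝ (Fin p)}
    {sigSq : ℕ → ℝ} {tauSq : ℕ → ℕ → ℝ} {tau2 : ℝ}
    {v : ∀ p : ℕ, Fin r → EuclideanSpace ℝ (Fin p)}
    {lamHat : ℕ → Ω → ℕ → ℝ} {uHat : ∀ p : ℕ, Ω → ℕ → EuclideanSpace ℝ (Fin p)}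
    (hX : ∀ p, n < p → IsSample P (X p) (mean p) (Sig p))
    (hSig : ∀ p, n < p → IsOrderedEigendecomposition p (Sig p) (lam p) (u p))
    (hspike : IsSpikedCovariance n m lam sigSq tauSq tau2)
    (hmix : IsMixingScores P
      (fun p k (i : Fin n) ω => pcScore (mean p) (lam p k) (u p k) (X p i ω)))
    (hv : ∀ p, n < p → ∀ j, ‖v p j‖ = 1)
    (hS : ∀ p, n < p → ∀ᵐ ω ∂P,
      IsOrderedEigendecomposition (n - 1) (sampleCov (fun i => X p i ω)) (lamHat p ω) (uHat p ω))
    {i₀ : ℕ} (hi₀ : i₀ < m) (j₀ : Fin r) {η : ℝ} (hη : 0 < η) :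
    Tendsto (fun p => P {ω | ¬ (IsUnit (ridgedMatrix n m (lamHat p ω) (uHat p ω)) ∧
      ridgedVector n m (lamHat p ω) (uHat p ω) (v p j₀) ≠ 0 ∧
      |InnerProductGeometry.angle (u p i₀)
          (ridgedVector n m (lamHat p ω) (uHat p ω) (v p j₀)) - Real.pi / 2| < η)})
      atTop (𝓝 0) := by
  have hlam : ∀ p, n < p → ∀ k < p, 0 < lam p k := fun p hp k hk => hspike.lam_pos hp hk
  obtain ⟨Z, hZ, hscore⟩ := exists_isWhiteScores hX hSig hlam hmix
  have hall : ∀ p, n < p → ∀ᵐ ω ∂P, ∀ k < p, ∀ i,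
      pcScore (mean p) (lam p k) (u p k) (X p i ω) = Z k i ω := fun p hp =>
    ae_all_iff.2 fun k => ae_all_iff.2 fun hk => ae_all_iff.2 fun i => hscore p hp k hk i
  obtain ⟨C, hC⟩ := hspike.bounded
  have hn0 : (0 : ℝ) < n := by
    have : 0 < n := by omega
    exact_mod_cast this
  have hm0 : (0 : ℝ) < m := by exact_mod_cast hm
  have htau : ∀ᶠ p in atTop, ∀ k < p, 0 < tauSq p k ∧ tauSq p k ≤ C := by
    filter_upwards [eventually_gt_atTop n] with p hp k hk
    exact ⟨hspike.tauSq_pos p hp k hk, hC p hp k hk⟩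
  -- Bounds for the spiked eigenvalues, relative to the dimension.
  obtain ⟨s, hs, hsl⟩ : ∃ s > 0, ∀ p, n < p → ∀ k < m, s * p ≤ lam p k := by
    obtain ⟨k₁, hk₁, hmin⟩ := (Finset.range m).exists_min_image sigSq
      ⟨0, Finset.mem_range.2 (by omega)⟩
    refine ⟨sigSq k₁, hspike.sigSq_pos _ (Finset.mem_range.1 hk₁), fun p hp k hk => ?_⟩
    rw [hspike.spiked p hp k hk]
    have h1 := hspike.tauSq_pos p hp k (by omega)
    have h2 := mul_le_mul_of_nonneg_right (hmin k (Finset.mem_range.2 hk))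
      (Nat.cast_nonneg (α := ℝ) p)
    linarith
  obtain ⟨B, hB, hBl⟩ : ∃ B ≥ 0, ∀ p, n < p → ∀ k < m, lam p k ≤ B * p := by
    obtain ⟨k₁, hk₁, hmax⟩ := (Finset.range m).exists_max_image sigSq
      ⟨0, Finset.mem_range.2 (by omega)⟩
    have h0 := hspike.sigSq_pos _ (Finset.mem_range.1 hk₁)
    refine ⟨sigSq k₁ + |C|, by positivity, fun p hp k hk => ?_⟩
    rw [hspike.spiked p hp k hk]
    have h1 := (hC p hp k (by omega)).trans (le_abs_self C)
    have h2 := mul_le_mul_of_nonneg_right (hmax k (Finset.mem_range.2 hk))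
      (Nat.cast_nonneg (α := ℝ) p)
    have h3 : (1 : ℝ) ≤ p := by
      have : 1 ≤ p := by omega
      exact_mod_cast this
    have h4 := le_mul_of_one_le_right (abs_nonneg C) h3
    linarith
  obtain ⟨ρ, hρ, hangle⟩ := exists_abs_angle_sub_pi_div_two_lt hη
  -- The leading scores do not depend on the dimension, hence neither does this random variable,
  -- which is therefore tight.
  set f : Ω → ℝ := fun ω => sumSqInv (scoreDiff hmn fun k i => Z k i ω)
    + ∑ i, ∑ k ∈ Finset.range m, Z k i ω ^ 2 with hf
  have hfm : Measurable f := by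
    refine (measurable_sumSqInv.comp (measurable_pi_lambda _ fun i => measurable_pi_lambda _
      fun k => ?_)).add (Finset.measurable_sum _ fun i _ => Finset.measurable_sum _ fun k _ =>
        (hZ.measurable k i).pow_const 2)
    exact (hZ.measurable _ _).sub (hZ.measurable _ _)
  have hunit : ∀ᵐ ω ∂P, IsUnit (Matrix.of (scoreDiff hmn fun k i => Z k i ω)) := by
    have hp : n < n + 1 := by omega
    filter_upwards [hall _ hp, (hX _ hp).ae_isUnit_scoreDiff (hSig _ hp).orthonormal
      (hlam _ hp) hmn hp]
      with ω h1 h2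
    have h3 : (scoreDiff hmn fun k i => Z k i ω) = scoreDiff hmn fun k i =>
        pcScore (mean (n + 1)) (lam (n + 1) k) (u (n + 1) k) (X (n + 1) i ω) := by
      ext i k
      simp only [scoreDiff]
      rw [h1 k (by omega), h1 k (by omega)]
    rwa [h3]
  rw [ENNReal.tendsto_nhds_zero]
  intro θ hθ
  obtain ⟨N, hN, hfN⟩ := exists_measure_lt_le (P := P) hfm (ENNReal.half_pos hθ.ne')
  obtain ⟨ε, hε, hcore⟩ := IsSpikedOperator.exists_noise_threshold m hspike.tau2_pos
    (by positivity : 0 < s / (4 * m * N)) (by positivity : 0 ≤ B * N) hρ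
  set δ : ℝ := ε / n with hδ
  have hδ0 : 0 < δ := by positivity
  have hnδ : n * δ = ε := by rw [hδ]; field_simp
  -- The deviations of the Gram matrix of the noise from `tau2` times the identity, and the noise
  -- in the direction of the reference vector.
  have hgram : ∀ i j, Tendsto (fun p : ℕ => P {ω | δ ≤
      |∑ k ∈ Finset.Ico m p, tauSq p k / p * (Z k i ω * Z k j ω) - if i = j then tau2 else 0|})
      atTop (𝓝 0) := by
    intro i j
    by_cases hij : i = j
    · subst hij
      simpa using hZ.tendsto_measure_le_abs_sq i m htau hspike.average hδ0
    · simpa [hij] using hZ.tendsto_measure_le_abs_cross hij m htau hδ0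
  have hlin : ∀ i, Tendsto (fun p : ℕ => P {ω | δ ≤
      |∑ k ∈ Finset.Ico m p, (√(tauSq p k) / √(p : ℝ) * inner ℝ (u p k) (v p j₀)) * Z k i ω|})
      atTop (𝓝 0) := by
    intro i
    refine hZ.tendsto_measure_le_abs_linear i m ?_ hδ0
    refine squeeze_zero' (Eventually.of_forall fun p => Finset.sum_nonneg fun k _ => sq_nonneg _)
      ?_ (tendsto_const_div_atTop_nhds_zero_nat |C|)
    filter_upwards [htau, eventually_gt_atTop n] with p hp hpn
    have hsub : Finset.Ico m p ⊆ Finset.range p := by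
      intro k; simp only [Finset.mem_range, Finset.mem_Ico]; omega
    calc _ ≤ ∑ k ∈ Finset.Ico m p, |C| / p * inner ℝ (u p k) (v p j₀) ^ 2 := by
          refine Finset.sum_le_sum fun k hk => ?_
          obtain ⟨h1, h2⟩ := hp k (Finset.mem_Ico.1 hk).2
          rw [mul_pow, div_pow, Real.sq_sqrt h1.le, Real.sq_sqrt (Nat.cast_nonneg p)]
          gcongr
          exact h2.trans (le_abs_self C)
      _ = |C| / p * ∑ k ∈ Finset.Ico m p, inner ℝ (u p k) (v p j₀) ^ 2 := by
          rw [Finset.mul_sum]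
      _ ≤ |C| / p * ‖v p j₀‖ ^ 2 := by
          gcongr
          exact sum_inner_sq_le_of_orthonormal_fin (hSig p hpn).orthonormal hsub _
      _ = _ := by rw [hv p hpn, one_pow, mul_one]
  have hsum : Tendsto (fun p : ℕ => (∑ i, ∑ j, P {ω | δ ≤
      |∑ k ∈ Finset.Ico m p, tauSq p k / p * (Z k i ω * Z k j ω) - if i = j then tau2 else 0|})
      + ∑ i, P {ω | δ ≤ |∑ k ∈ Finset.Ico m p,
        (√(tauSq p k) / √(p : ℝ) * inner ℝ (u p k) (v p j₀)) * Z k i ω|}) atTop (𝓝 0) := by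
    have := (tendsto_finsetSum Finset.univ fun i _ => tendsto_finsetSum Finset.univ fun j _ =>
      hgram i j).add (tendsto_finsetSum Finset.univ fun i _ => hlin i)
    simpa using this
  filter_upwards [eventually_gt_atTop n,
    ENNReal.tendsto_nhds_zero.1 hsum _ (ENNReal.half_pos hθ.ne')] with p hpn hsmall
  have hmp : m ≤ p := by omega
  set badGram : Fin n → Fin n → Set Ω := fun i j => {ω | δ ≤
    |∑ k ∈ Finset.Ico m p, tauSq p k / p * (Z k i ω * Z k j ω) - if i = j then tau2 else 0|}
  set badLin : Fin n → Set Ω := fun i => {ω | δ ≤ |∑ k ∈ Finset.Ico m p,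
    (√(tauSq p k) / √(p : ℝ) * inner ℝ (u p k) (v p j₀)) * Z k i ω|}
  have hu := (hSig p hpn).orthonormal
  -- The sample eigenvectors need not be measurable, so that the bad event is covered by events
  -- about the scores, up to a null set.
  have hcover : ∀ᵐ ω ∂P, ω ∈ {ω | ¬ (IsUnit (ridgedMatrix n m (lamHat p ω) (uHat p ω)) ∧
      ridgedVector n m (lamHat p ω) (uHat p ω) (v p j₀) ≠ 0 ∧
      |InnerProductGeometry.angle (u p i₀)
          (ridgedVector n m (lamHat p ω) (uHat p ω) (v p j₀)) - Real.pi / 2| < η)} →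
      ω ∈ {ω | N < f ω} ∪ ((⋃ i, ⋃ j, badGram i j) ∪ ⋃ i, badLin i) := by
    filter_upwards [hall p hpn, hunit, hS p hpn] with ω hzω hunitω hSω hbad
    by_contra hcon
    simp only [Set.mem_union, Set.mem_iUnion, not_or, not_exists] at hcon
    obtain ⟨hfω, hgramω, hlinω⟩ := hcon
    refine hbad ?_
    have hfω : f ω ≤ N := not_lt.1 hfω
    have hinv0 : 0 ≤ sumSqInv (scoreDiff hmn fun k i => Z k i ω) :=
      Finset.sum_nonneg fun _ _ => Finset.sum_nonneg fun _ _ => sq_nonneg _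
    have hsq0 : 0 ≤ ∑ i, ∑ k ∈ Finset.range m, Z k i ω ^ 2 :=
      Finset.sum_nonneg fun _ _ => Finset.sum_nonneg fun _ _ => sq_nonneg _
    have hz : ∀ k < p, ∀ i, inner ℝ (u p k) (X p i ω - mean p) = √(lam p k) * Z k i ω := by
      intro k hk i
      rw [inner_eq_sqrt_mul_pcScore (hlam p hpn k hk), hzω k hk i]
    have htail : ∀ k ∈ Finset.Ico m p, lam p k = tauSq p k := fun k hk =>
      hspike.nonspiked p hpn k (Finset.mem_Ico.1 hk).1 (Finset.mem_Ico.1 hk).2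
    have hop := isSpikedOperator_of_scores hu hm hmn hpn hSω
      (fun k hk => (hlam p hpn k hk).le) hz (z := fun k i => Z k i ω) hs.le hB hN hδ0.le
      (hsl p hpn) (hBl p hpn) hunitω (by simp only [hf] at hfω; linarith)
      (by simp only [hf] at hfω; linarith) (t := tau2) fun i j => by
        have h1 : ∑ k ∈ Finset.Ico m p, lam p k / p * (Z k i ω * Z k j ω)
            = ∑ k ∈ Finset.Ico m p, tauSq p k / p * (Z k i ω * Z k j ω) :=
          Finset.sum_congr rfl fun k hk => by rw [htail k hk]
        rw [h1]
        exact (not_le.1 (hgramω i j)).le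
    have hvn := norm_contrastAdjoint_sub_starProjection_le hu hmp hz hδ0.le (v p j₀) fun i => by
      have h1 : ∑ k ∈ Finset.Ico m p,
            (√(lam p k) / √(p : ℝ) * inner ℝ (u p k) (v p j₀)) * Z k i ω
          = ∑ k ∈ Finset.Ico m p,
            (√(tauSq p k) / √(p : ℝ) * inner ℝ (u p k) (v p j₀)) * Z k i ω :=
        Finset.sum_congr rfl fun k hk => by rw [htail k hk]
      rw [h1]
      exact (not_le.1 (hlinω i)).le
    rw [hnδ] at hop hvn
    obtain ⟨h1, h2, h3⟩ := hcore ε hε.le le_rfl hmn hop (finrank_leadingSpan hu hmp)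
      (hv p hpn j₀) hvn
    refine ⟨h1, h2, hangle _ _ ?_⟩
    have hnorm : ‖u p i₀‖ = 1 := hu.1 ⟨i₀, by omega⟩
    rw [hnorm, one_mul]
    refine lt_of_le_of_lt ?_ h3
    have h4 : (leadingSpan m (u p)).starProjection (u p i₀) = u p i₀ :=
      Submodule.starProjection_eq_self_iff.2 (mem_leadingSpan hi₀)
    rw [← h4, Submodule.inner_starProjection_left_eq_right]
    have h5 := abs_real_inner_le_norm (u p i₀) ((leadingSpan m (u p)).starProjection
      (ridgedVector n m (lamHat p ω) (uHat p ω) (v p j₀)))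
    rwa [hnorm, one_mul] at h5
  calc _ ≤ P ({ω | N < f ω} ∪ ((⋃ i, ⋃ j, badGram i j) ∪ ⋃ i, badLin i)) := measure_mono_ae hcover
    _ ≤ P {ω | N < f ω} + (∑ i, ∑ j, P (badGram i j) + ∑ i, P (badLin i)) := by
        refine (measure_union_le _ _).trans (add_le_add le_rfl ((measure_union_le _ _).trans
          (add_le_add ?_ (measure_iUnion_fintype_le _ _))))
        exact (measure_iUnion_fintype_le _ _).trans
          (Finset.sum_le_sum fun i _ => measure_iUnion_fintype_le _ _)
    _ ≤ θ / 2 + θ / 2 := add_le_add hfN hsmall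
    _ = θ := ENNReal.add_halves θ

end

theorem theorem4 {Ω : Type*} [MeasurableSpace Ω] (P : Measure Ω) [IsProbabilityMeasure P]
    (n m r : ℕ) (hm : 1 ≤ m) (hmn : m + 2 ≤ n)
    (X : ∀ p : ℕ, Fin n → Ω → EuclideanSpace ℝ (Fin p))
    (mean : ∀ p : ℕ, EuclideanSpace ℝ (Fin p))
    (Sig : ∀ p : ℕ, Matrix (Fin p) (Fin p) ℝ)
    (lam : ℕ → ℕ → ℝ) (u : ∀ p : ℕ, ℕ → EuclideanSpace ℝ (Fin p))
    (sigSq : ℕ → ℝ) (tauSq : ℕ → ℕ → ℝ) (tau2 : ℝ)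
    (v : ∀ p : ℕ, Fin r → EuclideanSpace ℝ (Fin p))
    (lamHat : ℕ → Ω → ℕ → ℝ) (uHat : ∀ p : ℕ, Ω → ℕ → EuclideanSpace ℝ (Fin p))
    (hX : ∀ p, n < p → IsSample P (X p) (mean p) (Sig p))
    (hSig : ∀ p, n < p → IsOrderedEigendecomposition p (Sig p) (lam p) (u p))
    (hspike : IsSpikedCovariance n m lam sigSq tauSq tau2)
    (hmix : IsMixingScores P
      (fun p k (i : Fin n) ω => pcScore (mean p) (lam p k) (u p k) (X p i ω)))
    (hv : ∀ p, n < p → ∀ j, ‖v p j‖ = 1)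
    (hvu : HasLimitingAlignment m u v)
    (hS : ∀ p, n < p → ∀ᵐ ω ∂P,
      IsOrderedEigendecomposition (n - 1) (sampleCov (fun i => X p i ω)) (lamHat p ω) (uHat p ω)) :
    ∀ i < m, ∀ j : Fin r,
      TendstoInMeasure P
        (fun p ω => InnerProductGeometry.angle (u p i)
          (ridgedVector n m (lamHat p ω) (uHat p ω) (v p j)))
        atTop (fun _ => Real.pi / 2) ∧
      Tendsto (fun p => P {ω | ¬ (IsUnit (ridgedMatrix n m (lamHat p ω) (uHat p ω)) ∧
        ridgedVector n m (lamHat p ω) (uHat p ω) (v p j) ≠ 0)}) atTop (𝓝 0) := by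
  intro i hi j
  have key : ∀ η : ℝ, 0 < η → _ := fun η hη =>
    tendsto_measure_not_almost_orthogonal P hm hmn hX hSig hspike hmix hv hS hi j hη
  constructor
  · rw [tendstoInMeasure_iff_dist]
    intro η hη
    refine tendsto_of_tendsto_of_tendsto_of_le_of_le tendsto_const_nhds (key η hη)
      (fun _ => zero_le) fun p => measure_mono fun ω hω hgood => ?_
    exact absurd hgood.2.2 (not_lt.2 hω)
  · refine tendsto_of_tendsto_of_tendsto_of_le_of_le tendsto_const_nhds (key 1 one_pos)
      (fun _ => zero_le) fun p => measure_mono fun ω hω hgood => ?_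
    exact hω ⟨hgood.1, hgood.2.1⟩
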